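/- **Setting.** A graph (in Serre's sense) has oriented edges $e$ with origin $\iota(e)$, terminus $\tau(e)$ and reverse $\bar e\ne e$; $\mathrm{St}(x)=\{e:\iota(e)=x\}$. Morphisms send vertices to vertices and edges to edges; an *immersion* is a morphism that is injective on stars. A *graph pair* $(\Gamma,\underline w)$ is a finite graph $\Gamma$ (possibly disconnected) without vertices of valence one, with an immersion $\underline w:\mathbb S_{\underline w}\to\Gamma$ of a finite disjoint union of circles. A morphism $(\Lambda,\underline u)\to(\Gamma,\underline w)$ consists of graph morphisms $\Lambda\to\Gamma$ and $\mathbb S_{\underline u}\to\mathbb S_{\underline w}$, the latter an immersion, commuting with $\underline u,\underline w$; it is an *immersion* $\looparrowright$ if $\Lambda\to\Gamma$ is an immersion and $\mathbb S_{\underline u}\to\Lambda\times\mathbb S_{\underline w}$ is injective (equivalently, the lifts to universal covers and to the fibre products of the universal covers with the multicycles are injective). A *$\partial$-immersion* is a concatenation $(\Lambda,\underline u)\to(\Delta,\underline v)\looparrowright(\Gamma,\underline w)$ with $\mathbb S_{\underline u}\to\mathbb S_{\underline v}$ bijective; it is *admissible* if there is $n>0$ such that every point of $\mathbb S_{\underline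 w}$ has exactly $n$ preimages in $\mathbb S_{\underline u}$. The *Whitehead graph* $\mathrm{Wh}_x(\underline w)$ at a vertex $x$ of $\Gamma$ has vertex set $\mathrm{St}(x)$ and one edge for each vertex $p$ of $\mathbb S_{\underline w}$ over $x$, joining the images of the two edges of $\mathbb S_{\underline w}$ that start at $p$; $\mathrm{Wh}(\underline w)=\coprod_x\mathrm{Wh}_x(\underline w)$. Reversal of edges gives bijections $i_e:\mathrm{St}(e)\to\mathrm{St}(\bar e)$ of stars in $\mathrm{Wh}(\underline w)$. A graph with at least two vertices is *irreducible* if it is connected and has no vertex of valence one and no cut vertex. A pair is *locally irreducible* if all its Whitehead graphs $\mathrm{Wh}_x$ are irreducible. Let $\mathcal P$ be the finite set of *pieces* $P\to U\hookrightarrow W$, up to isomorphism over $W$, where $W$ is a component of $\mathrm{Wh}(\underline w)$, $U\subseteq W$ is a subgraph, $P$ is a non-empty finite disjoint union of irreducible graphs, and $P\to U$ is onto and bijective on edges. For pieces $P\to U\hookrightarrow W_1$ and $Q\to V\hookrightarrow W_2$, write $P\leftrightarrow_eQ$ if $e$ is a vertex of $U$, $\bar e$ is a vertex of $V$, and $i_e$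 restricts to bijections from the stars in $P$ of the vertices over $e$ to the stars in $Q$ of the vertices over $\bar e$, for some bijection between these two sets of vertices. A *$\mathcal P$-star* $\sigma$ is a piece $\sigma(*)=(P\to U\hookrightarrow W)$ with a piece $\sigma(e)$ for each vertex $e$ of $U$, such that $P\leftrightarrow_e\sigma(e)$. Let $\mathcal S$ be the finite set of $\mathcal P$-stars. For an edge $\epsilon$ of $\mathrm{Wh}(\underline w)$ and $\underline x\in\mathbb R^{\mathcal S}$ let $n_\epsilon(\underline x)=\sum_\sigma x_\sigma\delta_\epsilon(\sigma(*))$, where $\delta_\epsilon(P)$ is the number of edges of $P$ over $\epsilon$. The cone $C_{\mathcal P}$ is the set of $\underline x\in\mathbb R_{\ge0}^{\mathcal S}$ satisfying the gluing equations $\sum_{\sigma(*)=P,\,\sigma(e)=Q}x_\sigma=\sum_{\sigma(*)=Q,\,\sigma(\bar e)=P}x_\sigma$, for all $P\leftrightarrow_eQ$, and the admissibility equations $n_\epsilon(\underline x)=n_{\epsilon'}(\underline x)$, for all $\epsilon,\epsilon'$. On it write $n=n_\epsilon$, and let $\chi_-(\underline x)=\sum_\sigma x_\sigma\left(\tfrac12\nu(\sigma(*))-\mu(\sigma(*))\right)$,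 where $\nu,\mu$ are the numbers of vertices and of connected components of the image $U$ of the piece. The *projective $\mathcal P$-rank* is $\rho_{\mathcal P}=\chi_- /n$ on $\mathbb P(C_{\mathcal P})$. For a $\partial$-immersion as above and a vertex $x$ of $\Delta$ over $x_0\in\Gamma$, let $P(x)$ be $\coprod_{x'\mapsto x}\mathrm{Wh}_{x'}(\underline u)\to\mathrm{Wh}_x(\underline v)\hookrightarrow\mathrm{Wh}_{x_0}(\underline w)$. The $\mathcal P$-star $\sigma_x$ has centre $P(x)$ and has $P(\tau(e))$ at each $e\in\mathrm{St}_\Delta(x)$. Let $\pi(\underline u)\in\mathbb R^{\mathcal S}$ have entries $\#\{x\in V(\Delta):\sigma_x=\sigma\}$. **Theorem.** Let $(\Gamma,\underline w)$ be a graph pair with $C_{\mathcal P}\ne0$. Then $n>0$ on $C_{\mathcal P}\smallsetminus0$, the function $\rho_{\mathcal P}$ attains a maximum $\rho^+_{\mathcal P}(\underline w)$ and a minimum $\rho^-_{\mathcal P}(\underline w)$ on $\mathbb P(C_{\mathcal P})$, and these are realized by admissible $\partial$-immersions of locally irreducible pairs: there exist locally irreducible pairs $(\Lambda_\pm,\underline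 u_\pm)$ and admissible $\partial$-immersions $(\Lambda_\pm,\underline u_\pm)\to(\Delta_\pm,\underline v_\pm)\looparrowright(\Gamma,\underline w)$ having a $\mathcal P$-star $\sigma_x$ at every vertex $x$ of $\Delta_\pm$, such that $\pi(\underline u_\pm)\in C_{\mathcal P}\smallsetminus0$ and $\rho_{\mathcal P}(\pi(\underline u_\pm))=\rho^\pm_{\mathcal P}(\underline w)$. In particular, $\rho^\pm_{\mathcal P}(\underline w)$ are non-negative rational numbers. Moreover: * both are positive if some component $w_i$ of $\underline w$ is not a proper power and has no non-zero power freely homotopic to a power of another component of $\underline w$; * $\rho^+_{\mathcal P}(\underline w)$ is positive if there is an admissible $\partial$-immersion $(\Lambda,\underline u)\to(\Delta,\underline v)\looparrowright(\Gamma,\underline w)$ with $(\Lambda,\underline u)$ locally irreducible, all Whitehead graphs $\mathrm{Wh}_x(\underline v)$ connected, and some vertex of $\Delta$ of valence at least three. -/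

import Mathlib

universe u

noncomputable section

/-- A graph in the sense of Serre: `bar` reverses an oriented edge, `src` is its origin. -/
structure SerreGraph where
  V : Type u
  E : Type u
  bar : E → E
  src : E → V
  bar_bar : ∀ e, bar (bar e) = e
  bar_ne : ∀ e, bar e ≠ e

namespace SerreGraph

variable (G : SerreGraph.{u})

/-- The terminus of an oriented edge. -/
def tgt (e : G.E) : G.V := G.src (G.bar e)

/-- The star of a vertex: the oriented edges with that origin. -/
def star (v : G.V) : Set G.E := {e | G.src e = v}

/-- `b` can be reached from `a` along an edge path. -/
def Reachable (a b : G.V) : Prop :=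
  Relation.ReflTransGen (fun p q => ∃ e, G.src e = p ∧ G.tgt e = q) a b

def Preconnected : Prop := ∀ a b, G.Reachable a b

/-- The empty graph is not connected. -/
def Connected : Prop := Nonempty G.V ∧ G.Preconnected

/-- The set of (vertex sets of) connected components. -/
def components : Set (Set G.V) := {C | ∃ a, C = {b | G.Reachable a b}}

/-- The full subgraph spanned by a set of vertices. -/
abbrev induce (A : Set G.V) : SerreGraph.{u} where
  V := {v // v ∈ A}
  E := {e // G.src e ∈ A ∧ G.tgt e ∈ A}
  bar e := ⟨G.bar e.1, e.2.2, by unfold tgt; rw [G.bar_bar]; exact e.2.1⟩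
  src e := ⟨G.src e.1, e.2.1⟩
  bar_bar e := Subtype.ext (G.bar_bar e.1)
  bar_ne e h := G.bar_ne e.1 (congrArg Subtype.val h)

/-- Removing `v` disconnects the graph. -/
def IsCutVertex (v : G.V) : Prop := ¬ (G.induce {v}ᶜ).Preconnected

/-- An irreducible (Whitehead) graph: connected, without leaves (vertices of valence one) and
without cut vertices. The graph consisting of a single vertex is excluded; it is never a Whitehead
graph of a graph pair, as these have no vertex of valence one. -/
def Irreducible : Prop :=
  G.Connected ∧ Nontrivial G.V ∧ (∀ v, (G.star v).ncard ≠ 1) ∧ ∀ v, ¬ G.IsCutVertex v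

/-- Every connected component is an irreducible graph. -/
def IsUnionOfIrreducibles : Prop := ∀ v, (G.induce {a | G.Reachable v a}).Irreducible

/-- A morphism of graphs: vertices go to vertices and edges to edges. -/
structure Hom (G H : SerreGraph.{u}) where
  onV : G.V → H.V
  onE : G.E → H.E
  src_onE : ∀ e, H.src (onE e) = onV (G.src e)
  bar_onE : ∀ e, H.bar (onE e) = onE (G.bar e)

/-- An immersion is a morphism that is injective on stars. -/
def Hom.IsImmersion {G H : SerreGraph.{u}} (f : G.Hom H) : Prop :=
  ∀ v, Set.InjOn f.onE (G.star v)

end SerreGraph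

open SerreGraph

/-- A graph pair: a finite graph `Γ` without vertices of valence one together with a multicycle,
i.e. an immersion `w : S → Γ` of a (finite) disjoint union `S` of circles. A finite graph is a
disjoint union of circles exactly when all its vertices have valence two. -/
structure GraphPair where
  Γ : SerreGraph.{u}
  S : SerreGraph.{u}
  w : S.Hom Γ
  finite_ΓV : Finite Γ.V
  finite_ΓE : Finite Γ.E
  finite_SV : Finite S.V
  finite_SE : Finite S.E
  valence_ne_one : ∀ x, (Γ.star x).ncard ≠ 1
  circles : ∀ p, (S.star p).ncard = 2
  immersion : w.IsImmersion

attribute [instance] GraphPair.finite_ΓV GraphPair.finite_ΓE GraphPair.finite_SV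
  GraphPair.finite_SE

namespace GraphPair

variable (X : GraphPair.{u})

theorem exists_opp (d : X.S.E) : ∃ d', X.S.src d' = X.S.src d ∧ d' ≠ d := by
  obtain ⟨a, b, hab, h⟩ := Set.ncard_eq_two.1 (X.circles (X.S.src d))
  have ha : a ∈ X.S.star (X.S.src d) := by rw [h]; simp
  have hb : b ∈ X.S.star (X.S.src d) := by rw [h]; simp
  by_cases hd : a = d
  · exact ⟨b, hb, fun hbd => hab (hd.trans hbd.symm)⟩
  · exact ⟨a, ha, hd⟩

/-- The other edge of the multicycle with the same origin as `d`. -/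
def opp (d : X.S.E) : X.S.E := (X.exists_opp d).choose

theorem src_opp (d : X.S.E) : X.S.src (X.opp d) = X.S.src d := (X.exists_opp d).choose_spec.1

theorem opp_ne (d : X.S.E) : X.opp d ≠ d := (X.exists_opp d).choose_spec.2

theorem opp_opp (d : X.S.E) : X.opp (X.opp d) = d := by
  obtain ⟨a, b, hab, h⟩ := Set.ncard_eq_two.1 (X.circles (X.S.src d))
  have m : ∀ d', X.S.src d' = X.S.src d → d' = a ∨ d' = b := by
    intro d' hd'
    have : d' ∈ X.S.star (X.S.src d) := hd'
    rw [h] at this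
    simpa using this
  have h1 := X.opp_ne d
  have h2 := X.opp_ne (X.opp d)
  have m0 := m d rfl
  have m1 := m _ (X.src_opp d)
  have m2 := m _ ((X.src_opp (X.opp d)).trans (X.src_opp d))
  grind

/-- The Whitehead graph `Wh(w)`, the disjoint union of the `Wh_x(w)`: its vertices are the oriented
edges of `Γ`, and its unoriented edges are the vertices `p` of `S`, where `p` joins the images of
the two edges `d`, `opp d` issuing from `p`. So an oriented edge of `Wh(w)` is an oriented edge `d`
of `S`, with origin `w d` and reverse `opp d`. The bijection from the star of `e` in `Wh(w)` to the
star of `bar e` is `d ↦ bar d`. -/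
abbrev wh : SerreGraph.{u} where
  V := X.Γ.E
  E := X.S.E
  bar := X.opp
  src := X.w.onE
  bar_bar := X.opp_opp
  bar_ne := X.opp_ne

/-- The Whitehead graph at the vertex `x`. -/
abbrev whAt (x : X.Γ.V) : SerreGraph.{u} := X.wh.induce (X.Γ.star x)

def LocallyIrreducible : Prop := ∀ x, (X.whAt x).Irreducible

/-- Following the multicycle: the edge of `S` that comes after `d`. -/
def next (d : X.S.E) : X.S.E := X.opp (X.S.bar d)

/-- Some oriented edge `d` of the multicycle is determined by the infinite path in `Γ` that one
reads off from `d` onwards: no other oriented edge of `S` yields the same path. Equivalently, some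
component of `w` is not a proper power and has no non-zero power freely homotopic to a power of
another component. -/
def HasIsolatedCycle : Prop :=
  ∃ d, ∀ d', (∀ k : ℕ, X.w.onE (X.next^[k] d') = X.w.onE (X.next^[k] d)) → d' = d

/-- A morphism of graph pairs `(Λ, u) → (Γ, w)`. -/
structure Hom (Y X : GraphPair.{u}) where
  onΓ : Y.Γ.Hom X.Γ
  onS : Y.S.Hom X.S
  commV : ∀ p, X.w.onV (onS.onV p) = onΓ.onV (Y.w.onV p)
  commE : ∀ d, X.w.onE (onS.onE d) = onΓ.onE (Y.w.onE d)
  immersion_onS : onS.IsImmersion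

/-- An immersion of graph pairs. The graph morphism has to be injective on universal covers, which
means that it is an immersion; and the induced map of fibre products
`{(x̃, p) | x̃ over the image of p}` of universal cover and multicycle has to be injective,
which then means that a point of `Y.S` is determined by its images in `Y.Γ` and `X.S`. -/
def Hom.IsImmersion {Y X : GraphPair.{u}} (f : Y.Hom X) : Prop :=
  f.onΓ.IsImmersion ∧
  (∀ p q, Y.w.onV p = Y.w.onV q → f.onS.onV p = f.onS.onV q → p = q) ∧
  (∀ d d', Y.w.onE d = Y.w.onE d' → f.onS.onE d = f.onS.onE d' → d = d')

/-! ### Pieces and stars -/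

/-- A graph `P` over `Wh(w)`, injective on edges and without isolated vertices, up to isomorphism
over `Wh(w)`. It is recorded by its oriented edges, viewed as oriented edges of `Wh(w)`, and by the
relation `rel a b`: "`a` and `b` are oriented edges of `P` with the same origin in `P`". Thus `rel`
is an equivalence relation on the set `{d | rel d d}` of oriented edges of `P`, and its classes are
the vertices of `P`. -/
structure PrePiece where
  rel : X.S.E → X.S.E → Prop
  symm : ∀ {a b}, rel a b → rel b a
  trans : ∀ {a b c}, rel a b → rel b c → rel a c
  opp_mem : ∀ {a}, rel a a → rel (X.opp a) (X.opp a)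
  onE_eq : ∀ {a b}, rel a b → X.w.onE a = X.w.onE b

namespace PrePiece

variable {X} (P : X.PrePiece)

/-- The oriented edges of `P`. -/
abbrev Dart : Type u := {d : X.S.E // P.rel d d}

def vertexSetoid : Setoid P.Dart where
  r a b := P.rel a.1 b.1
  iseqv := ⟨fun a => a.2, P.symm, P.trans⟩

/-- The graph `P`. -/
abbrev graph : SerreGraph.{u} where
  V := Quotient P.vertexSetoid
  E := P.Dart
  bar d := ⟨X.opp d.1, P.opp_mem d.2⟩
  src d := Quotient.mk P.vertexSetoid d
  bar_bar d := Subtype.ext (X.opp_opp d.1)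
  bar_ne d h := X.opp_ne d.1 (congrArg Subtype.val h)

/-- The vertices of the image `U` of `P` in `Wh(w)`. -/
def support : Set X.Γ.E := {e | ∃ d, P.rel d d ∧ X.w.onE d = e}

/-- The image `U` of `P` in `Wh(w)`. -/
abbrev image : SerreGraph.{u} where
  V := {e // e ∈ P.support}
  E := P.Dart
  bar d := ⟨X.opp d.1, P.opp_mem d.2⟩
  src d := ⟨X.w.onE d.1, d.1, d.2, rfl⟩
  bar_bar d := Subtype.ext (X.opp_opp d.1)
  bar_ne d h := X.opp_ne d.1 (congrArg Subtype.val h)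

end PrePiece

/-- A piece `P → U ↪ W`, up to isomorphism: `W` is a component of `Wh(w)`, `U` is a (nonempty)
subgraph of `W`, `P` is a disjoint union of irreducible graphs and `P → U` is onto and bijective on
edges. -/
structure Piece extends X.PrePiece where
  nonempty : ∃ d, rel d d
  one_component : ∀ a b, rel a a → rel b b → X.wh.Reachable (X.w.onE a) (X.w.onE b)
  irreducible : toPrePiece.graph.IsUnionOfIrreducibles

theorem Piece.rel_injective : Function.Injective (fun P : X.Piece => P.rel) := by
  rintro @⟨@⟨r, _, _, _, _⟩, _, _, _⟩ @⟨@⟨r', _, _, _, _⟩, _, _, _⟩ h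
  cases h
  rfl

instance : Finite X.Piece := Finite.of_injective _ (Piece.rel_injective X)

variable {X}

/-- `P ↔_e Q`: `e` is a vertex of the image of `P`, and reversal of edges (the canonical bijection
from the star of `e` to the star of `bar e`) carries the stars of the vertices of `P` over `e`
bijectively to the stars of the vertices of `Q` over `bar e`. -/
def Piece.Glue (e : X.Γ.E) (P Q : X.Piece) : Prop :=
  e ∈ P.support ∧ X.Γ.bar e ∈ Q.support ∧
  ∀ d d', X.w.onE d = e → X.w.onE d' = e → (P.rel d d' ↔ Q.rel (X.S.bar d) (X.S.bar d'))

variable (X)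

/-- A `𝒫`-star: a piece `P → U ↪ W` and, for every vertex `e` of `U`, a piece `Q` with
`P ↔_e Q`. -/
structure PStar where
  center : X.Piece
  nbr : {e // e ∈ center.support} → X.Piece
  glue : ∀ e, Piece.Glue e.1 center (nbr e)

instance : Finite X.PStar := by
  refine Finite.of_injective
    (fun σ => (⟨σ.center, σ.nbr⟩ : Σ P : X.Piece, {e // e ∈ P.support} → X.Piece)) ?_
  rintro ⟨c, n, _⟩ ⟨c', n', _⟩ h
  cases h
  rfl

instance : Fintype X.PStar := Fintype.ofFinite _

variable {X}

/-- `σ(e) = Q`; in particular `e` is a vertex of the image of `σ(*)`. -/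
def PStar.LabelEq (σ : X.PStar) (e : X.Γ.E) (Q : X.Piece) : Prop :=
  ∃ h : e ∈ σ.center.support, σ.nbr ⟨e, h⟩ = Q

/-! ### The cone and the rank -/

open Classical in
/-- The gluing equation for `P`, `Q` and `e`. -/
def GluingEq (x : X.PStar → ℝ) (e : X.Γ.E) (P Q : X.Piece) : Prop :=
  (∑ σ : X.PStar with σ.center = P ∧ σ.LabelEq e Q, x σ) =
    ∑ σ : X.PStar with σ.center = Q ∧ σ.LabelEq (X.Γ.bar e) P, x σ

open Classical in
/-- The number (0 or 1) of edges of `P` over the edge `ε` of `Wh(w)`, i.e. vertex `ε` of `S`. -/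
def delta (ε : X.S.V) (P : X.Piece) : ℝ :=
  if ∃ d, X.S.src d = ε ∧ P.rel d d then 1 else 0

/-- The linear form `n_ε`. -/
def nAt (ε : X.S.V) (x : X.PStar → ℝ) : ℝ := ∑ σ, x σ * delta ε σ.center

variable (X)

/-- The cone of non-negative vectors that satisfy the gluing and the admissibility equations. -/
def cone : Set (X.PStar → ℝ) :=
  {x | (∀ σ, 0 ≤ x σ) ∧ (∀ e P Q, Piece.Glue e P Q → GluingEq x e P Q) ∧
    ∀ ε ε', nAt ε x = nAt ε' x}

variable {X}

open Classical in
/-- The degree `n`, which is the common value of the `n_ε` on the cone. (If the multicycle is empty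
then there are no pieces and the cone is zero.) -/
def degree (x : X.PStar → ℝ) : ℝ :=
  if h : Nonempty X.S.V then nAt h.some x else 0

/-- `ν/2 - μ`, where the image of the piece has `ν` vertices and `μ` components. -/
def weight (P : X.Piece) : ℝ :=
  (Nat.card P.image.V : ℝ) / 2 - (P.image.components.ncard : ℝ)

/-- The linear form `χ₋`. -/
def chiMinus (x : X.PStar → ℝ) : ℝ := ∑ σ, x σ * weight σ.center

/-- The projective `𝒫`-rank `ρ = χ₋ / n`, invariant under scaling of `x`. -/
def rank (x : X.PStar → ℝ) : ℝ := chiMinus x / degree x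

variable (X)

/-- The values of `ρ` on the projectivization of the cone. -/
def rankValues : Set ℝ := rank '' {x | x ∈ X.cone ∧ x ≠ 0}

/-- The maximal `𝒫`-rank. -/
def maxRank : ℝ := sSup X.rankValues

/-- The minimal `𝒫`-rank. -/
def minRank : ℝ := sInf X.rankValues

/-! ### Boundary immersions -/

/-- A `∂`-immersion `(Λ, u) → (Δ, v) ↬ (Γ, w)`. -/
structure BdryImmersion (L D X : GraphPair.{u}) where
  fst : L.Hom D
  snd : D.Hom X
  snd_immersion : snd.IsImmersion
  bijV : Function.Bijective fst.onS.onV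
  bijE : Function.Bijective fst.onS.onE

namespace BdryImmersion

variable {X} {L D : GraphPair.{u}} (F : BdryImmersion L D X)

/-- The map of multicycles, on vertices. -/
def sV (p : L.S.V) : X.S.V := F.snd.onS.onV (F.fst.onS.onV p)

/-- The map of multicycles, on edges. -/
def sE (d : L.S.E) : X.S.E := F.snd.onS.onE (F.fst.onS.onE d)

/-- Every point of the multicycle of `X` has the same number `n > 0` of preimages. -/
def Admissible : Prop :=
  ∃ n : ℕ, 0 < n ∧ (∀ p, {q | F.sV q = p}.ncard = n) ∧ ∀ d, {d' | F.sE d' = d}.ncard = n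

/-- `P` is the piece of the vertex `x` of `Δ`: the disjoint union, over the vertices `x'` of `Λ`
above `x`, of the Whitehead graphs `Wh_x'(u)`, mapped to `Wh(w)`. -/
def IsPieceAt (x : D.Γ.V) (P : X.Piece) : Prop :=
  ∀ a b, P.rel a b ↔ ∃ d d', F.sE d = a ∧ F.sE d' = b ∧ L.w.onE d = L.w.onE d' ∧
    F.fst.onΓ.onV (L.Γ.src (L.w.onE d)) = x

/-- `σ` is the `𝒫`-star `σ_x` of the vertex `x` of `Δ`: its centre is the piece of `x`, and its
label at an edge issuing from `x` is the piece of the other end of that edge. -/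
def IsStarAt (x : D.Γ.V) (σ : X.PStar) : Prop :=
  F.IsPieceAt x σ.center ∧ ∀ e, D.Γ.src e = x →
    ∃ Q, F.IsPieceAt (D.Γ.tgt e) Q ∧ σ.LabelEq (F.snd.onΓ.onE e) Q

/-- The vector `π(u)`: its entry at `σ` is the number of vertices `x` of `Δ` with `σ_x = σ`. -/
def piVec (σ : X.PStar) : ℝ := ({x | F.IsStarAt x σ}.ncard : ℝ)

/-- An admissible `∂`-immersion of a locally irreducible pair with a `𝒫`-star at every vertex of
`Δ`, for which the vector `π(u)` lies in the cone, is non-zero and has rank `r`. -/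
def Realizes (r : ℝ) : Prop :=
  L.LocallyIrreducible ∧ F.Admissible ∧ (∀ x, ∃! σ, F.IsStarAt x σ) ∧
    F.piVec ∈ X.cone ∧ F.piVec ≠ 0 ∧ rank F.piVec = r

end BdryImmersion

end GraphPair

end

/-! The cone is cut out of the non-negative orthant by equations between sums of coordinates. The
centre of a star `σ` contains an edge, so `x σ ≤ n` (`le_degree`). Hence `n > 0` away from zero, the
slice `n = 1` is compact, and `χ₋` attains its extrema there.

An extremal `x` is replaced by an integral vector without using vertices of polytopes. A `ℚ`-linear
functional `ℝ → ℚ` that is positive on the positive coordinates of `x` preserves the equations;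
after clearing denominators it yields a natural vector `m` of the cone with the support of `x`.
Since `x - t m` stays in the cone for some `t > 0`, linearity makes `m` extremal as well
(`exists_nat_extremal`). Its rank is visibly rational.

A natural vector `m` is realized by taking `m σ` copies of each star `σ`. The gluing equations say
that half-edges labelled `(e, P, Q)` and `(bar e, Q, P)` are equally numerous, so they can be
matched (`exists_nodeMatching`); this builds `Δ`. Splitting each vertex of `Δ` into the components
of its centre, and each edge into the vertices of the centre over it, gives `Λ`. Its Whitehead
graphs are components of pieces, hence irreducible, and the admissibility equations become
admissibility of the `∂`-immersion (`exists_realizes`).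

For positivity, each component of the image of a piece has at least two vertices, so weights are
non-negative and vanish only if all components have exactly two. If `χ₋` vanishes, two distinct
strands at a vertex of a piece therefore run parallel forever, which an isolated cycle forbids
(`chiMinus_pos_of_hasIsolatedCycle`). Conversely, an admissible `∂`-immersion with connected
Whitehead graphs of `v` defines a vector of the cone (`piVec_mem_cone`), and a vertex of valence at
least three contributes positive weight. -/

namespace SerreGraph

/-! ### Paths, morphisms and irreducibility of graphs. -/

variable {G H : SerreGraph.{u}}

theorem tgt_bar (e : G.E) : G.tgt (G.bar e) = G.src e := congrArg G.src (G.bar_bar e)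

theorem bar_injective : Function.Injective G.bar := fun a b h => by
  rw [← G.bar_bar a, h, G.bar_bar]

theorem Reachable.refl (a : G.V) : G.Reachable a a := Relation.ReflTransGen.refl

theorem Reachable.of_edge (e : G.E) : G.Reachable (G.src e) (G.tgt e) :=
  Relation.ReflTransGen.single ⟨e, rfl, rfl⟩

theorem Reachable.trans {a b c : G.V} (h : G.Reachable a b) (h' : G.Reachable b c) :
    G.Reachable a c := Relation.ReflTransGen.trans h h'

theorem Reachable.symm {a b : G.V} (h : G.Reachable a b) : G.Reachable b a := by
  induction h with
  | refl => exact .refl _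
  | tail _ h ih =>
    obtain ⟨e, rfl, rfl⟩ := h
    exact (Relation.ReflTransGen.single ⟨G.bar e, rfl, tgt_bar e⟩ :
      G.Reachable (G.tgt e) (G.src e)).trans ih

theorem Hom.tgt_onE (f : G.Hom H) (e : G.E) : H.tgt (f.onE e) = f.onV (G.tgt e) := by
  unfold tgt
  rw [f.bar_onE, f.src_onE]

theorem Reachable.map (f : G.Hom H) {a b : G.V} (h : G.Reachable a b) :
    H.Reachable (f.onV a) (f.onV b) := by
  refine Relation.ReflTransGen.lift f.onV ?_ _ _ h
  rintro _ _ ⟨e, rfl, rfl⟩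
  exact ⟨f.onE e, f.src_onE e, f.tgt_onE e⟩

/-- A function that is constant along edges is constant along paths. -/
theorem Reachable.apply_eq {α : Type*} (f : G.V → α) (hf : ∀ e, f (G.src e) = f (G.tgt e))
    {a b : G.V} (h : G.Reachable a b) : f a = f b := by
  induction h with
  | refl => rfl
  | tail _ h ih =>
    obtain ⟨e, rfl, rfl⟩ := h
    rw [ih, hf]

/-- In a connected graph with more than one vertex every vertex is the origin of an edge. -/
theorem Connected.exists_src_eq (h : G.Connected) [Nontrivial G.V] (v : G.V) :
    ∃ e, G.src e = v := by
  obtain ⟨b, hb⟩ := exists_ne v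
  rcases Relation.ReflTransGen.cases_head (h.2 v b) with h | ⟨_, ⟨e, he, _⟩, _⟩
  · exact absurd h.symm hb
  · exact ⟨e, he⟩

/-- The restriction of a morphism to full subgraphs. -/
def Hom.induce (f : G.Hom H) (A : Set G.V) (B : Set H.V) (h : ∀ a ∈ A, f.onV a ∈ B) :
    (G.induce A).Hom (H.induce B) where
  onV a := ⟨f.onV a.1, h _ a.2⟩
  onE e := ⟨f.onE e.1, by rw [f.src_onE]; exact h _ e.2.1, by rw [f.tgt_onE]; exact h _ e.2.2⟩
  src_onE e := Subtype.ext (f.src_onE e.1)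
  bar_onE e := Subtype.ext (f.bar_onE e.1)

/-- Irreducibility is invariant under isomorphisms. -/
theorem Hom.irreducible (f : G.Hom H) (hV : Function.Bijective f.onV)
    (hE : Function.Bijective f.onE) (h : G.Irreducible) : H.Irreducible := by
  obtain ⟨⟨⟨v₀⟩, hc⟩, hn, hl, hcut⟩ := h
  refine ⟨⟨⟨f.onV v₀⟩, ?_⟩, hV.1.nontrivial, ?_, ?_⟩
  · intro a b
    obtain ⟨a, rfl⟩ := hV.2 a
    obtain ⟨b, rfl⟩ := hV.2 b
    exact (hc a b).map f
  · intro v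
    obtain ⟨v, rfl⟩ := hV.2 v
    have : H.star (f.onV v) = f.onE '' G.star v := by
      ext e
      obtain ⟨e, rfl⟩ := hE.2 e
      simp only [star, Set.mem_ofPred_eq, hE.1.mem_set_image, f.src_onE, hV.1.eq_iff]
    rw [this, Set.ncard_image_of_injective _ hE.1]
    exact hl v
  · intro v
    obtain ⟨v, rfl⟩ := hV.2 v
    have hv := hcut v
    unfold IsCutVertex at hv ⊢
    rw [not_not] at hv ⊢
    rintro ⟨a, ha⟩ ⟨b, hb⟩
    obtain ⟨a, rfl⟩ := hV.2 a
    obtain ⟨b, rfl⟩ := hV.2 b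
    exact (hv ⟨a, fun h => ha (congrArg f.onV h)⟩ ⟨b, fun h => hb (congrArg f.onV h)⟩).map
      (f.induce {v}ᶜ {f.onV v}ᶜ fun a ha h => ha (hV.1 h))

/-- An injective morphism that is surjective on stars maps isomorphically onto a full subgraph. -/
theorem Hom.irreducible_induce_range (f : G.Hom H) (hV : Function.Injective f.onV)
    (hE : Function.Injective f.onE) (hs : ∀ v e, H.src e = f.onV v → ∃ e', f.onE e' = e)
    (h : G.Irreducible) : (H.induce (Set.range f.onV)).Irreducible := by
  refine Hom.irreducible (G := G)
    { onV := fun v => ⟨f.onV v, v, rfl⟩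
      onE := fun e => ⟨f.onE e, ⟨_, (f.src_onE e).symm⟩, ⟨_, (f.tgt_onE e).symm⟩⟩
      src_onE := fun e => Subtype.ext (f.src_onE e)
      bar_onE := fun e => Subtype.ext (f.bar_onE e) }
    ⟨fun a b hab => hV (congrArg Subtype.val hab), ?_⟩
    ⟨fun a b hab => hE (congrArg Subtype.val hab), ?_⟩ h
  · rintro ⟨_, v, rfl⟩
    exact ⟨v, rfl⟩
  · rintro ⟨e, ⟨v, hv⟩, he⟩
    obtain ⟨e, rfl⟩ := hs v e hv.symm
    exact ⟨e, rfl⟩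

/-- The image of a connected graph under a morphism that is surjective on stars is a component. -/
theorem Hom.range_onV_eq (f : G.Hom H)
    (hs : ∀ v e, H.src e = f.onV v → ∃ e', f.onE e' = e) (h : G.Preconnected) (v : G.V) :
    Set.range f.onV = {b | H.Reachable (f.onV v) b} := by
  ext b
  constructor
  · rintro ⟨a, rfl⟩
    exact (h v a).map f
  · intro hb
    induction hb with
    | refl => exact ⟨v, rfl⟩
    | tail _ h ih =>
      obtain ⟨e, rfl, rfl⟩ := h
      obtain ⟨a, ha⟩ := ih
      obtain ⟨e, rfl⟩ := hs a e ha.symm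
      exact ⟨_, (f.tgt_onE e).symm⟩

/-- Surjectivity on stars makes the image a whole component. This is how irreducibility passes from
pieces to Whitehead graphs of `Λ`, and back. -/
theorem Hom.irreducible_component (f : G.Hom H) (hV : Function.Injective f.onV)
    (hE : Function.Injective f.onE) (hs : ∀ v e, H.src e = f.onV v → ∃ e', f.onE e' = e)
    (h : G.Irreducible) (v : G.V) :
    (H.induce {b | H.Reachable (f.onV v) b}).Irreducible := by
  rw [← f.range_onV_eq hs h.1.2 v]
  exact f.irreducible_induce_range hV hE hs h

end SerreGraph

/-! ### Two tools: rational functionals and colour-reversing involutions. -/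

/-- A rational linear functional that is positive on finitely many given positive numbers. -/
theorem exists_rat_functional_pos {ι : Type*} [Finite ι] (x : ι → ℝ) :
    ∃ φ : ℝ →ₗ[ℚ] ℚ, ∀ i, 0 < x i → 0 < φ (x i) := by
  classical
  have := Fintype.ofFinite ι
  let V := Submodule.span ℚ (Set.range x)
  have : FiniteDimensional ℚ V := FiniteDimensional.span_of_finite ℚ (Set.finite_range x)
  let b := Module.finBasis ℚ V
  let X : ι → V := fun i => ⟨x i, Submodule.subset_span ⟨i, rfl⟩⟩
  -- `U` is the set of real values for the basis vectors under which every positive `x i` becomes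
  -- positive. It is open and contains the actual values of the basis, so by density it contains a
  -- rational point.
  let U : Set (Fin (Module.finrank ℚ V) → ℝ) :=
    ⋂ i : {i // 0 < x i}, {r | 0 < ∑ j, (b.repr (X i) j : ℝ) * r j}
  have hU : IsOpen U := isOpen_iInter_of_finite fun i =>
    isOpen_lt continuous_const (by fun_prop)
  have hne : U.Nonempty := by
    refine ⟨fun j => (b j : ℝ), Set.mem_iInter.2 fun i => ?_⟩
    have h := congrArg Subtype.val (b.sum_repr (X i))
    simp only [AddSubmonoidClass.coe_finsetSum, SetLike.val_smul, Rat.smul_def] at h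
    simp only [Set.mem_ofPred_eq, h]
    exact i.2
  have hd : DenseRange (fun (q : Fin (Module.finrank ℚ V) → ℚ) j => (q j : ℝ)) :=
    DenseRange.piMap fun _ => Rat.denseRange_cast
  obtain ⟨q, hq⟩ := hd.exists_mem_open hU hne
  let φ₀ : V →ₗ[ℚ] ℚ := b.constr ℚ q
  obtain ⟨φ, hφ⟩ := LinearMap.exists_extend φ₀
  refine ⟨φ, fun i hi => ?_⟩
  have h1 : φ (x i) = φ₀ (X i) := congrArg (fun ψ => ψ (X i)) hφ
  rw [h1, Module.Basis.constr_apply_fintype]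
  have := Set.mem_iInter.1 hq ⟨i, hi⟩
  simp only [Set.mem_ofPred_eq] at this
  simp only [Module.Basis.equivFun_apply, smul_eq_mul]
  exact_mod_cast this

/-- A finite set that is coloured such that the colour classes of `k` and `κ k` have equally many
elements, where `κ` is an involution, has an involution that induces `κ` on the colours. -/
theorem exists_involution_of_card_fiber {α K : Type*} [Finite α] (c : α → K) (κ : K → K)
    (hκ : ∀ k, κ (κ k) = k) (hcard : ∀ k, {a | c a = k}.ncard = {a | c a = κ k}.ncard) :
    ∃ β : α → α, (∀ a, β (β a) = a) ∧ ∀ a, c (β a) = κ (c a) := by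
  classical
  -- Each colour class is numbered; the involution keeps the number and changes the colour by `κ`.
  let f : ∀ k, {a | c a = k} ≃ Fin (Nat.card {a | c a = k}) := fun k => Finite.equivFin _
  let idx : α → ℕ := fun a => (f (c a) ⟨a, rfl⟩).1
  have hidx : ∀ k a (h : c a = k), idx a = (f k ⟨a, h⟩).1 := by
    rintro _ a rfl
    rfl
  have hinj : ∀ a b, c a = c b → idx a = idx b → a = b := by
    intro a b h h'
    rw [hidx (c b) a h, hidx (c b) b rfl] at h'
    exact congrArg Subtype.val ((f (c b)).injective (Fin.ext h'))
  have hex : ∀ a, ∃ b, c b = κ (c a) ∧ idx b = idx a := by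
    intro a
    have hlt : idx a < Nat.card {b | c b = κ (c a)} := by
      have h := hcard (c a)
      rw [← Nat.card_coe_set_eq, ← Nat.card_coe_set_eq] at h
      rw [← h]
      exact (f (c a) ⟨a, rfl⟩).2
    let b := (f (κ (c a))).symm ⟨idx a, hlt⟩
    refine ⟨b.1, b.2, ?_⟩
    rw [hidx _ _ b.2]
    exact congrArg Fin.val (Equiv.apply_symm_apply (f (κ (c a))) ⟨idx a, hlt⟩)
  choose β hβ hβ' using hex
  refine ⟨β, fun a => hinj _ _ ?_ ?_, hβ⟩
  · rw [hβ, hβ, hκ]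
  · rw [hβ', hβ']

/-! ### Whitehead graphs, pieces and matchings of half-edges. -/

noncomputable section

open SerreGraph

namespace GraphPair

variable (X : GraphPair.{u})

theorem eq_or_eq_opp {d d' : X.S.E} (h : X.S.src d' = X.S.src d) : d' = d ∨ d' = X.opp d := by
  by_contra! hne
  have h3 : ({d, X.opp d, d'} : Set X.S.E).ncard = 3 := by
    rw [Set.ncard_eq_three]
    exact ⟨_, _, _, (X.opp_ne d).symm, hne.1.symm, hne.2.symm, rfl⟩
  have := Set.ncard_le_ncard (s := {d, X.opp d, d'}) (t := X.S.star (X.S.src d)) (by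
    rintro _ (rfl | rfl | rfl)
    exacts [rfl, X.src_opp d, h])
  rw [X.circles, h3] at this
  omega

variable {X}

theorem opp_eq {d d' : X.S.E} (h : X.S.src d' = X.S.src d) (hne : d' ≠ d) : X.opp d = d' :=
  ((X.eq_or_eq_opp h).resolve_left hne).symm

theorem eq_of_src_eq {d d' : X.S.E} (h : X.S.src d = X.S.src d')
    (h' : X.w.onE d = X.w.onE d') : d = d' :=
  X.immersion (X.S.src d) rfl h.symm h'

/-- Whitehead graphs have no loops, because the multicycle is immersed. -/
theorem w_opp_ne (d : X.S.E) : X.w.onE (X.opp d) ≠ X.w.onE d :=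
  fun h => X.opp_ne d (eq_of_src_eq (X.src_opp d) h)

/-- The Whitehead graph has no edges between different stars. -/
theorem src_eq_of_reachable {e e' : X.Γ.E} (h : X.wh.Reachable e e') :
    X.Γ.src e = X.Γ.src e' := by
  refine Reachable.apply_eq (G := X.wh) X.Γ.src (fun d => ?_) h
  change X.Γ.src (X.w.onE d) = X.Γ.src (X.w.onE (X.opp d))
  rw [X.w.src_onE, X.w.src_onE, X.src_opp]

namespace PrePiece

variable (P : X.PrePiece)

theorem rel_left {a b : X.S.E} (h : P.rel a b) : P.rel a a := P.trans h (P.symm h)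

theorem rel_right {a b : X.S.E} (h : P.rel a b) : P.rel b b := P.trans (P.symm h) h

theorem opp_mem_iff {a : X.S.E} : P.rel (X.opp a) (X.opp a) ↔ P.rel a a :=
  ⟨fun h => by simpa only [X.opp_opp] using P.opp_mem h, P.opp_mem⟩

theorem mem_congr {a b : X.S.E} (h : X.S.src a = X.S.src b) : P.rel a a ↔ P.rel b b := by
  rcases X.eq_or_eq_opp h with rfl | rfl
  exacts [Iff.rfl, P.opp_mem_iff]

theorem exists_src_iff (a : X.S.E) :
    (∃ d, X.S.src d = X.S.src a ∧ P.rel d d) ↔ P.rel a a :=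
  ⟨fun ⟨_, h, h'⟩ => (P.mem_congr h).1 h', fun h => ⟨a, rfl, h⟩⟩

end PrePiece

theorem Piece.ext_rel {P Q : X.Piece} (h : ∀ a b, P.rel a b ↔ Q.rel a b) : P = Q :=
  Piece.rel_injective X (funext₂ fun a b => propext (h a b))

theorem Piece.Glue.symm {e : X.Γ.E} {P Q : X.Piece} (h : Piece.Glue e P Q) :
    Piece.Glue (X.Γ.bar e) Q P := by
  refine ⟨h.2.1, by rw [X.Γ.bar_bar]; exact h.1, fun d d' hd hd' => ?_⟩
  have := h.2.2 (X.S.bar d) (X.S.bar d') (by rw [← X.w.bar_onE, hd, X.Γ.bar_bar])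
    (by rw [← X.w.bar_onE, hd', X.Γ.bar_bar])
  rw [X.S.bar_bar, X.S.bar_bar] at this
  exact this.symm

/-- The vertex of `Γ` under a piece. -/
def Piece.base (P : X.Piece) : X.Γ.V := X.Γ.src (X.w.onE P.nonempty.choose)

theorem Piece.src_eq_base (P : X.Piece) {d : X.S.E} (h : P.rel d d) :
    X.Γ.src (X.w.onE d) = P.base :=
  src_eq_of_reachable (P.one_component _ _ h P.nonempty.choose_spec)

/-! ### Realization of integral vectors -/

/-- The vertices of a graph with `m σ` vertices of type `σ`. -/
abbrev Node (m : X.PStar → ℕ) : Type u := Σ σ : X.PStar, Fin (m σ)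

/-- The half-edges at these vertices. -/
abbrev NodeEdge (m : X.PStar → ℕ) : Type u :=
  {a : Node m × X.Γ.E // a.2 ∈ a.1.1.center.support}

/-- The label of a half-edge. -/
def NodeEdge.nbr {m : X.PStar → ℕ} (a : NodeEdge m) : X.Piece := a.1.1.1.nbr ⟨a.1.2, a.2⟩

/-- A way to join the half-edges in pairs according to their labels. -/
structure NodeMatching (m : X.PStar → ℕ) where
  mate : NodeEdge m → NodeEdge m
  mate_mate : ∀ a, mate (mate a) = a
  snd_mate : ∀ a, (mate a).1.2 = X.Γ.bar a.1.2
  center_mate : ∀ a, (mate a).1.1.1.center = a.nbr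

theorem ncard_node (m : X.PStar → ℕ) (p : X.PStar → Prop) [DecidablePred p] :
    {s : Node m | p s.1}.ncard = ∑ σ with p σ, m σ := by
  classical
  rw [← Nat.card_coe_set_eq, Nat.card_congr (β := Σ σ : {σ // p σ}, Fin (m σ.1))
    { toFun := fun s => ⟨⟨s.1.1, s.2⟩, s.1.2⟩
      invFun := fun s => ⟨⟨s.1.1, s.2⟩, s.1.2⟩
      left_inv := fun _ => rfl
      right_inv := fun _ => rfl }]
  rw [Nat.card_sigma]
  simp only [Nat.card_eq_fintype_card, Fintype.card_fin]
  rw [← Finset.sum_subtype_eq_sum_filter]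
  exact Finset.sum_congr (by ext; simp) fun _ _ => rfl

/-- Colour a half-edge by its direction, its own piece and its label. The gluing equations compare
the colour classes exchanged by reversal. -/
theorem exists_nodeMatching (m : X.PStar → ℕ)
    (hm : ∀ e P Q, Piece.Glue e P Q → GluingEq (fun σ => (m σ : ℝ)) e P Q) :
    Nonempty (NodeMatching m) := by
  classical
  let c : NodeEdge m → X.Γ.E × X.Piece × X.Piece := fun a => (a.1.2, a.1.1.1.center, a.nbr)
  let κ : X.Γ.E × X.Piece × X.Piece → X.Γ.E × X.Piece × X.Piece :=
    fun k => (X.Γ.bar k.1, k.2.2, k.2.1)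
  have hfib : ∀ e P Q, {a | c a = (e, P, Q)}.ncard =
      ∑ σ with σ.center = P ∧ PStar.LabelEq σ e Q, m σ := by
    intro e P Q
    rw [← ncard_node]
    refine Set.ncard_congr (fun a _ => a.1.1) ?_ ?_ ?_
    · rintro a ha
      simp only [c, Set.mem_ofPred_eq, Prod.mk.injEq] at ha
      obtain ⟨rfl, h2, h3⟩ := ha
      exact ⟨h2, a.2, h3⟩
    · rintro ⟨⟨s, e⟩, h⟩ ⟨⟨s', e'⟩, h'⟩ ha hb hab
      simp only [c, Set.mem_ofPred_eq, Prod.mk.injEq] at ha hb hab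
      obtain ⟨rfl, -⟩ := ha
      obtain ⟨rfl, -⟩ := hb
      subst hab
      rfl
    · rintro s ⟨h1, h2, h3⟩
      exact ⟨⟨(s, e), h2⟩, by
        simp only [c, Set.mem_ofPred_eq, Prod.mk.injEq]; exact ⟨trivial, h1, h3⟩, rfl⟩
  have hempty : ∀ e P Q, ¬ Piece.Glue e P Q → {a | c a = (e, P, Q)} = ∅ := by
    intro e P Q h
    rw [Set.eq_empty_iff_forall_notMem]
    intro a ha
    simp only [c, Set.mem_ofPred_eq, Prod.mk.injEq] at ha
    obtain ⟨rfl, rfl, rfl⟩ := ha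
    exact h (a.1.1.1.glue ⟨a.1.2, a.2⟩)
  have hκ : ∀ k, κ (κ k) = k := fun k => by simp only [κ, X.Γ.bar_bar]
  obtain ⟨β, h1, h2⟩ := exists_involution_of_card_fiber c κ hκ (by
    rintro ⟨e, P, Q⟩
    by_cases h : Piece.Glue e P Q
    · have := hm e P Q h
      unfold GluingEq at this
      rw [hfib]
      refine Eq.trans ?_ (hfib (X.Γ.bar e) Q P).symm
      beta_reduce at this
      exact_mod_cast this
    -- For triples that cannot be glued there is no equation, but both colour classes are empty.
    · rw [hempty _ _ _ h, hempty]
      intro h'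
      have := h'.symm
      simp only [X.Γ.bar_bar] at this
      exact h this)
  exact ⟨⟨β, h1, fun a => congrArg Prod.fst (h2 a), fun a => congrArg (fun k => k.2.1) (h2 a)⟩⟩

end GraphPair

/-! ### The pairs `Δ` and `Λ` built from a matching. -/

namespace GraphPair

variable {X : GraphPair.{u}}

namespace NodeMatching

variable {m : X.PStar → ℕ} (M : NodeMatching m)

/-- Adjacent centres agree along the joining edge. This makes reversal well defined on the
multicycle and on the edges of `Λ`. -/
theorem rel_mate (a : NodeEdge m) {d d' : X.S.E} (hd : X.w.onE d = a.1.2)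
    (h : a.1.1.1.center.rel d d') :
    (M.mate a).1.1.1.center.rel (X.S.bar d) (X.S.bar d') := by
  rw [M.center_mate]
  exact ((a.1.1.1.glue ⟨a.1.2, a.2⟩).2.2 d d' hd
    ((a.1.1.1.center.onE_eq h).symm.trans hd)).1 h

/-- The oriented edges of the multicycle of the realization. -/
abbrev Dart (_ : NodeMatching m) : Type u := {t : Node m × X.S.E // t.1.1.center.rel t.2 t.2}

variable {M} in
/-- The half-edge along which an oriented edge of the multicycle runs. -/
def Dart.edge (t : M.Dart) : NodeEdge m := ⟨(t.1.1, X.w.onE t.1.2), t.1.2, t.2, rfl⟩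

variable {M} in
def Dart.bar (t : M.Dart) : M.Dart :=
  ⟨((M.mate t.edge).1.1, X.S.bar t.1.2), M.rel_mate t.edge rfl t.2⟩

theorem Dart.edge_bar (t : M.Dart) : t.bar.edge = M.mate t.edge :=
  Subtype.ext (Prod.ext rfl ((X.w.bar_onE t.1.2).symm.trans (M.snd_mate t.edge).symm))

theorem Dart.bar_bar (t : M.Dart) : t.bar.bar = t := by
  refine Subtype.ext (Prod.ext ?_ (X.S.bar_bar _))
  change (M.mate t.bar.edge).1.1 = t.1.1
  rw [Dart.edge_bar, M.mate_mate]
  rfl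

variable {M} in
def Dart.opp (t : M.Dart) : M.Dart := ⟨(t.1.1, X.opp t.1.2), t.1.1.1.center.opp_mem t.2⟩

theorem Dart.opp_opp (t : M.Dart) : t.opp.opp = t :=
  Subtype.ext (Prod.ext rfl (X.opp_opp _))

/-- The multicycle of the realization. -/
abbrev cycles : SerreGraph.{u} where
  V := {t : Node m × X.S.V // ∃ d, X.S.src d = t.2 ∧ t.1.1.center.rel d d}
  E := M.Dart
  bar := Dart.bar
  src t := ⟨(t.1.1, X.S.src t.1.2), t.1.2, rfl, t.2⟩
  bar_bar := Dart.bar_bar M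
  bar_ne t h := X.S.bar_ne t.1.2 (congrArg (fun t => t.1.2) h)

/-- The graph `Δ` of the realization. -/
abbrev base : SerreGraph.{u} where
  V := Node m
  E := NodeEdge m
  bar := M.mate
  src a := a.1.1
  bar_bar := M.mate_mate
  bar_ne a h := X.Γ.bar_ne a.1.2 ((M.snd_mate a).symm.trans (congrArg (fun t => t.1.2) h))

/-- Two oriented edges of the multicycle are related if they have the same origin in the disjoint
union of the centers. -/
def setoid : Setoid M.Dart where
  r t t' := t.1.1 = t'.1.1 ∧ t.1.1.1.center.rel t.1.2 t'.1.2
  iseqv :=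
    { refl := fun t => ⟨rfl, t.2⟩
      symm := fun {t t'} h => ⟨h.1.symm, by rw [← h.1]; exact t.1.1.1.center.symm h.2⟩
      trans := fun {t t' t''} h h' => ⟨h.1.trans h'.1, t.1.1.1.center.trans h.2 (by
        rw [h.1]; exact h'.2)⟩ }

theorem edge_eq_of_rel {t t' : M.Dart} (h : M.setoid.r t t') : t.edge = t'.edge :=
  Subtype.ext (Prod.ext h.1 (t.1.1.1.center.onE_eq h.2))

/-- The disjoint union of the centers. -/
abbrev centers : SerreGraph.{u} where
  V := Quotient M.setoid
  E := M.Dart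
  bar := Dart.opp
  src := Quotient.mk M.setoid
  bar_bar := Dart.opp_opp M
  bar_ne t h := X.opp_ne t.1.2 (congrArg (fun t => t.1.2) h)

def centersEdge : M.centers.V → NodeEdge m :=
  Quotient.lift Dart.edge fun _ _ => M.edge_eq_of_rel

def reachableSetoid (G : SerreGraph.{u}) : Setoid G.V where
  r := G.Reachable
  iseqv := ⟨Reachable.refl, Reachable.symm, Reachable.trans⟩

/-- The graph `Λ` of the realization. -/
abbrev total : SerreGraph.{u} where
  V := Quotient (reachableSetoid M.centers)
  E := Quotient M.setoid
  bar := Quotient.map Dart.bar fun t t' h =>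
    ⟨congrArg (fun a => (M.mate a).1.1) (M.edge_eq_of_rel h), M.rel_mate t.edge rfl h.2⟩
  src := Quotient.mk _
  bar_bar := by
    rintro ⟨t⟩
    exact congrArg (Quotient.mk _) (Dart.bar_bar M t)
  bar_ne := by
    rintro ⟨t⟩ h
    have := (M.edge_eq_of_rel (Quotient.exact h))
    rw [Dart.edge_bar] at this
    exact M.base.bar_ne _ this

theorem Dart.eq_of {t t' : M.Dart} (h : t.1.1 = t'.1.1) (h' : t.1.2 = t'.1.2) : t = t' :=
  Subtype.ext (Prod.ext h h')

theorem ncard_star_cycles (p : M.cycles.V) : (M.cycles.star p).ncard = 2 := by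
  obtain ⟨⟨s, p⟩, d, hp : X.S.src d = p, hd⟩ := p
  subst hp
  let t : M.Dart := ⟨(s, d), hd⟩
  refine Set.ncard_eq_two.2 ⟨t, t.opp, (M.centers.bar_ne t).symm, ?_⟩
  ext t'
  simp only [SerreGraph.star, Set.mem_ofPred_eq, Set.mem_insert_iff, Set.mem_singleton_iff,
    Subtype.mk.injEq, Prod.mk.injEq]
  constructor
  · rintro ⟨h1, h2⟩
    exact (X.eq_or_eq_opp h2).imp (Dart.eq_of M h1) (Dart.eq_of M h1)
  · rintro (rfl | rfl)
    exacts [⟨rfl, rfl⟩, ⟨rfl, X.src_opp d⟩]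

/-- The pair `(Δ, v)` of the realization. -/
abbrev basePair : GraphPair.{u} where
  Γ := M.base
  S := M.cycles
  w :=
    { onV := fun p => p.1.1
      onE := Dart.edge
      src_onE := fun _ => rfl
      bar_onE := fun t => (Dart.edge_bar M t).symm }
  finite_ΓV := inferInstance
  finite_ΓE := inferInstance
  finite_SV := inferInstance
  finite_SE := inferInstance
  valence_ne_one := by
    intro s h
    obtain ⟨a, ha⟩ := Set.ncard_eq_one.1 h
    obtain ⟨d, hd⟩ := s.1.center.nonempty
    let t : M.Dart := ⟨(s, d), hd⟩
    have h1 : t.edge ∈ M.base.star s := rfl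
    have h2 : t.opp.edge ∈ M.base.star s := rfl
    rw [ha, Set.mem_singleton_iff] at h1 h2
    exact w_opp_ne d (congrArg (fun a => a.1.2) (h2.trans h1.symm))
  circles := M.ncard_star_cycles
  immersion := by
    rintro _ t rfl t' ht' h
    exact Dart.eq_of M (congrArg (fun a => a.1.1) h)
      (eq_of_src_eq (congrArg (fun p => p.1.2) ht').symm (congrArg (fun a => a.1.2) h))

/-- The pair `(Λ, u)` of the realization. -/
abbrev totalPair : GraphPair.{u} where
  Γ := M.total
  S := M.cycles
  w :=
    -- A vertex of the multicycle is an unoriented edge of a centre. One orientation is chosen; both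
    -- ends lie in the same component, so the choice is immaterial.
    { onV := fun p => Quotient.mk _ (Quotient.mk M.setoid
        ⟨(p.1.1, p.2.choose), p.2.choose_spec.2⟩)
      onE := Quotient.mk _
      src_onE := fun t => by
        let p := M.cycles.src t
        let t' : M.Dart := ⟨(p.1.1, p.2.choose), p.2.choose_spec.2⟩
        refine Quotient.sound (?_ : M.centers.Reachable (M.centers.src t) (M.centers.src t'))
        rcases X.eq_or_eq_opp p.2.choose_spec.1 with h | h
        · rw [Dart.eq_of M (t := t') (t' := t) rfl h]
          exact .refl _
        · rw [Dart.eq_of M (t := t') (t' := t.opp) rfl h]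
          exact Reachable.of_edge (G := M.centers) t
      bar_onE := fun _ => rfl }
  finite_ΓV := inferInstance
  finite_ΓE := inferInstance
  finite_SV := inferInstance
  finite_SE := inferInstance
  valence_ne_one := by
    rintro ⟨⟨t⟩⟩ h
    obtain ⟨a, ha⟩ := Set.ncard_eq_one.1 h
    have h1 : M.centers.src t ∈ M.total.star (Quotient.mk _ (M.centers.src t)) := rfl
    have h2 : M.centers.src t.opp ∈ M.total.star (Quotient.mk _ (M.centers.src t)) :=
      Quotient.sound (s := reachableSetoid M.centers) (Reachable.of_edge (G := M.centers) t).symm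
    have h1' : M.centers.src t = a := ha.subset h1
    have h2' : M.centers.src t.opp = a := ha.subset h2
    exact w_opp_ne t.1.2
      (congrArg (fun a => (M.centersEdge a).1.2) (h2'.trans h1'.symm))
  circles := M.ncard_star_cycles
  immersion := by
    rintro _ t rfl t' ht' h
    have h := M.edge_eq_of_rel (Quotient.exact h)
    exact Dart.eq_of M (congrArg (fun a => a.1.1) h)
      (eq_of_src_eq (congrArg (fun p => p.1.2) ht').symm (congrArg (fun a => a.1.2) h))

/-- `opp` on a graph pair is defined by choice; the fact that stars of circles have two elements
identifies it with the explicit `Dart.opp`. -/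
theorem opp_totalPair (t : M.Dart) : M.totalPair.opp t = t.opp :=
  opp_eq (X := M.totalPair) (d := t) (d' := t.opp)
    (Subtype.ext (Prod.ext rfl (X.src_opp _))) (M.centers.bar_ne t)

theorem reachable_wh_totalPair_iff {a b : M.centers.V} :
    M.totalPair.wh.Reachable a b ↔ M.centers.Reachable a b := by
  let f : M.centers.Hom M.totalPair.wh := ⟨id, id, fun _ => rfl, M.opp_totalPair⟩
  let g : M.totalPair.wh.Hom M.centers := ⟨id, id, fun _ => rfl, fun t => (M.opp_totalPair t).symm⟩
  exact ⟨fun h => h.map g, fun h => h.map f⟩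

/-- The inclusion of a component of a center. -/
def centerHom (s : Node m) (A : Set s.1.center.graph.V) :
    (s.1.center.graph.induce A).Hom M.totalPair.wh where
  onV v := Quotient.map (sb := M.setoid) (fun d => ⟨(s, d.1), d.2⟩) (fun _ _ h => ⟨rfl, h⟩) v.1
  onE e := ⟨(s, e.1.1), e.1.2⟩
  src_onE _ := rfl
  bar_onE _ := M.opp_totalPair _

/-- The vertices of `Λ` are the components of the centres, and the Whitehead graph at such a vertex
is that component, which is irreducible by the definition of a piece. -/
theorem totalPair_locallyIrreducible : M.totalPair.LocallyIrreducible := by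
  rintro ⟨⟨⟨⟨s, d⟩, hd⟩⟩⟩
  let v₀ : s.1.center.graph.V := s.1.center.graph.src ⟨d, hd⟩
  let f := M.centerHom s {a | s.1.center.graph.Reachable v₀ a}
  have key := f.irreducible_component ?_ ?_ ?_ (s.1.center.irreducible v₀) ⟨v₀, .refl _⟩
  · convert key using 2
    ext a
    refine Iff.trans ?_ M.reachable_wh_totalPair_iff.symm
    exact ⟨fun h => (Quotient.exact (s := reachableSetoid M.centers) h).symm,
      fun h => Quotient.sound (s := reachableSetoid M.centers) h.symm⟩
  · rintro ⟨⟨d⟩, h⟩ ⟨⟨d'⟩, h'⟩ hd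
    exact Subtype.ext (Quotient.sound (Quotient.exact hd).2)
  · intro e e' h
    exact Subtype.ext (Subtype.ext (congrArg (fun t => t.1.2) h))
  · rintro ⟨⟨d⟩, h⟩ ⟨⟨s', d'⟩, h'⟩ hd
    obtain ⟨h1, h2⟩ := Quotient.exact hd
    obtain rfl : s' = s := h1
    let G := s'.1.center.graph
    have hd' : G.Reachable v₀ (G.src ⟨d', h'⟩) := h.trans (by
      rw [show G.src ⟨d', h'⟩ = G.src d from Quotient.sound h2]
      exact .refl _)
    exact ⟨⟨⟨d', h'⟩, hd', hd'.trans (.of_edge _)⟩, rfl⟩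

end NodeMatching

end GraphPair

/-! ### The `∂`-immersion of the realization and its vector. -/

namespace GraphPair

variable {X : GraphPair.{u}}

namespace NodeMatching

variable {m : X.PStar → ℕ} (M : NodeMatching m)

/-- The `∂`-immersion of the realization. -/
def bdryImmersion : BdryImmersion M.totalPair M.basePair X where
  fst :=
    { onΓ :=
        -- Edges of `centers` stay within one node, so the node is constant on components.
        { onV := Quotient.lift (fun v : M.centers.V => (M.centersEdge v).1.1) fun a b h =>
            Reachable.apply_eq (G := M.centers) (fun v => (M.centersEdge v).1.1) (fun _ => rfl) h
          onE := M.centersEdge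
          src_onE := by
            rintro ⟨t⟩
            rfl
          bar_onE := by
            rintro ⟨t⟩
            exact (Dart.edge_bar M t).symm }
      onS := ⟨id, id, fun _ => rfl, fun _ => rfl⟩
      commV := fun _ => rfl
      commE := fun _ => rfl
      immersion_onS := fun _ => Function.injective_id.injOn }
  snd :=
    { onΓ :=
        { onV := fun s => s.1.center.base
          onE := fun a => a.1.2
          src_onE := by
            rintro ⟨⟨s, e⟩, d, hd, he : X.w.onE d = e⟩
            subst he
            exact s.1.center.src_eq_base hd
          bar_onE := fun a => (M.snd_mate a).symm }
      onS := ⟨fun p => p.1.2, fun t => t.1.2, fun _ => rfl, fun _ => rfl⟩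
      commV := by
        rintro ⟨⟨s, p⟩, d, hp : X.S.src d = p, hd⟩
        subst hp
        exact (X.w.src_onE d).symm.trans (s.1.center.src_eq_base hd)
      commE := fun _ => rfl
      immersion_onS := fun p t ht t' ht' h =>
        Dart.eq_of M (congrArg (fun p => p.1.1) (ht.trans ht'.symm)) h }
  snd_immersion := ⟨fun _ _ ha _ hb h => Subtype.ext (Prod.ext (ha.trans hb.symm) h),
    fun _ _ h h' => Subtype.ext (Prod.ext h h'),
    fun _ _ h h' => Dart.eq_of M (congrArg (fun a => a.1.1) h) h'⟩
  bijV := Function.bijective_id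
  bijE := Function.bijective_id

theorem isPieceAt_iff (s : Node m) (P : X.Piece) :
    M.bdryImmersion.IsPieceAt s P ↔ P = s.1.center := by
  have h : M.bdryImmersion.IsPieceAt s s.1.center := by
    intro a b
    constructor
    · intro h
      exact ⟨⟨(s, a), s.1.center.rel_left h⟩, ⟨(s, b), s.1.center.rel_right h⟩, rfl, rfl,
        Quotient.sound ⟨rfl, h⟩, rfl⟩
    · rintro ⟨t, t', rfl, rfl, h, rfl⟩
      exact (Quotient.exact h).2
  refine ⟨fun h' => Piece.ext_rel fun a b => (h' a b).trans (h a b).symm, ?_⟩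
  rintro rfl
  exact h

theorem isStarAt_iff (s : Node m) (σ : X.PStar) :
    M.bdryImmersion.IsStarAt s σ ↔ σ = s.1 := by
  constructor
  · rintro ⟨h1, h2⟩
    rw [isPieceAt_iff] at h1
    obtain ⟨c, n, g⟩ := σ
    obtain ⟨⟨c', n', g'⟩, i⟩ := s
    obtain rfl : c = c' := h1
    congr 1
    funext e
    obtain ⟨Q, hQ, _, hQ'⟩ := h2 ⟨(_, e.1), e.2⟩ rfl
    rw [isPieceAt_iff] at hQ
    exact hQ'.trans (hQ.trans (M.center_mate _))
  · rintro rfl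
    refine ⟨(M.isPieceAt_iff s _).2 rfl, ?_⟩
    rintro a rfl
    exact ⟨a.nbr, (M.isPieceAt_iff _ _).2 (M.center_mate a).symm, a.2, rfl⟩

theorem piVec_bdryImmersion : M.bdryImmersion.piVec = fun σ => (m σ : ℝ) := by
  classical
  funext σ
  have : {x | M.bdryImmersion.IsStarAt x σ} = {s : Node m | σ = s.1} :=
    Set.ext fun s => M.isStarAt_iff s σ
  rw [BdryImmersion.piVec, this, ncard_node (p := fun τ => σ = τ), Nat.cast_sum,
    Finset.sum_filter, Finset.sum_ite_eq, if_pos (Finset.mem_univ σ)]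

end NodeMatching

/-- All coefficients of `n_ε` are 0 or 1. As a plain sum of coordinates it commutes with rational
functionals and counts nodes. -/
theorem nAt_eq (ε : X.S.V) (x : X.PStar → ℝ)
    [DecidablePred fun σ : X.PStar => ∃ d, X.S.src d = ε ∧ σ.center.rel d d] :
    nAt ε x = ∑ σ with ∃ d, X.S.src d = ε ∧ PrePiece.rel σ.center.toPrePiece d d, x σ := by
  rw [nAt, Finset.sum_filter]
  refine Finset.sum_congr rfl fun σ _ => ?_
  unfold delta
  split_ifs <;> simp

theorem exists_src_eq (p : X.S.V) : ∃ d, X.S.src d = p := by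
  by_contra! h
  have := X.circles p
  rw [show X.S.star p = ∅ from Set.eq_empty_iff_forall_notMem.2 h] at this
  simp at this

theorem degree_eq {x : X.PStar → ℝ} (hx : x ∈ X.cone) (ε : X.S.V) : nAt ε x = degree x := by
  have h : Nonempty X.S.V := ⟨ε⟩
  rw [degree, dif_pos h]
  exact hx.2.2 _ _

theorem le_degree {x : X.PStar → ℝ} (hx : x ∈ X.cone) (σ : X.PStar) : x σ ≤ degree x := by
  classical
  obtain ⟨d, hd⟩ := σ.center.nonempty
  rw [← degree_eq hx (X.S.src d), nAt_eq]
  exact Finset.single_le_sum (fun τ _ => hx.1 τ) (by simpa using ⟨d, rfl, hd⟩)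

theorem degree_pos {x : X.PStar → ℝ} (hx : x ∈ X.cone) (h0 : x ≠ 0) : 0 < degree x := by
  obtain ⟨σ, hσ⟩ := Function.ne_iff.1 h0
  exact (lt_of_le_of_ne (hx.1 σ) (Ne.symm hσ)).trans_le (le_degree hx σ)

theorem exists_realizes {m : X.PStar → ℕ} (hm : (fun σ => (m σ : ℝ)) ∈ X.cone)
    (h0 : (fun σ => (m σ : ℝ)) ≠ 0) :
    ∃ (L D : GraphPair.{u}) (F : BdryImmersion L D X),
      F.Realizes (rank fun σ => (m σ : ℝ)) := by
  classical
  obtain ⟨M⟩ := exists_nodeMatching m hm.2.1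
  refine ⟨M.totalPair, M.basePair, M.bdryImmersion, M.totalPair_locallyIrreducible, ?_,
    fun s => ⟨s.1, (M.isStarAt_iff s _).2 rfl, fun σ => (M.isStarAt_iff s σ).1⟩, ?_, ?_, ?_⟩
  rotate_left
  · rwa [M.piVec_bdryImmersion]
  · rwa [M.piVec_bdryImmersion]
  · rw [M.piVec_bdryImmersion]
  -- A node contributes a preimage of `p` exactly when its centre contains the edge `p`, and then
  -- only one.
  have hV : ∀ p, ({q | M.bdryImmersion.sV q = p}.ncard : ℝ) = degree fun σ => (m σ : ℝ) := by
    intro p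
    rw [← degree_eq hm p, nAt_eq, ← Nat.cast_sum, ← ncard_node, Nat.cast_inj]
    refine Set.ncard_congr (fun q _ => q.1.1) ?_ ?_ ?_
    · rintro ⟨q, hq⟩ rfl
      exact hq
    · rintro ⟨⟨s, p⟩, h⟩ ⟨⟨s', p'⟩, h'⟩ rfl hp hs
      exact Subtype.ext (Prod.ext hs hp.symm)
    · rintro s hs
      exact ⟨⟨(s, p), hs⟩, rfl, rfl⟩
  have hE : ∀ d, ({t | M.bdryImmersion.sE t = d}.ncard : ℝ) = degree fun σ => (m σ : ℝ) := by
    intro d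
    rw [← degree_eq hm (X.S.src d), nAt_eq, ← Nat.cast_sum, ← ncard_node, Nat.cast_inj]
    refine Set.ncard_congr (fun t _ => t.1.1) ?_ ?_ ?_
    · rintro ⟨⟨s, d⟩, h⟩ rfl
      exact ⟨d, rfl, h⟩
    · rintro t t' h h' hs
      exact NodeMatching.Dart.eq_of M hs (Eq.trans h h'.symm)
    · rintro s hs
      exact ⟨⟨(s, d), (s.1.center.exists_src_iff d).1 hs⟩, rfl, rfl⟩
  -- A nonzero vector provides an edge `d` of the multicycle, whose number of preimages expresses
  -- the real number `degree` as a natural number.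
  obtain ⟨σ, hσ⟩ := Function.ne_iff.1 h0
  obtain ⟨d, hd⟩ := σ.center.nonempty
  refine ⟨{t | M.bdryImmersion.sE t = d}.ncard, ?_, fun p => ?_, fun d' => ?_⟩
  · have h := degree_pos hm h0
    rw [← hE d] at h
    exact_mod_cast h
  · exact_mod_cast (hV p).trans (hE d).symm
  · exact_mod_cast (hE d').trans (hE d).symm

end GraphPair

/-! ### Passage from real to natural vectors. -/

/-- Nonnegative real numbers can be replaced by natural numbers without destroying any rational
linear relation. -/
theorem exists_nat_specialization {ι : Type*} [Fintype ι] (x : ι → ℝ) (hx : ∀ i, 0 ≤ x i) :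
    ∃ (ψ : ℝ →ₗ[ℚ] ℚ) (m : ι → ℕ), (∀ i, (m i : ℚ) = ψ (x i)) ∧ ∀ i, m i = 0 ↔ x i = 0 := by
  classical
  obtain ⟨φ, hφ⟩ := exists_rat_functional_pos x
  have hφ0 : ∀ i, 0 ≤ φ (x i) := fun i => by
    rcases (hx i).eq_or_lt with h | h
    · rw [← h, map_zero]
    · exact (hφ i h).le
  let N : ℕ := ∏ i, (φ (x i)).den
  -- This is `N * φ (x i)`: the numerator times the other denominators. `toNat` loses nothing, as
  -- the values are non-negative.
  let m : ι → ℕ := fun i => (φ (x i)).num.toNat * ∏ j ∈ Finset.univ.erase i, (φ (x j)).den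
  have hm : ∀ i, (m i : ℚ) = N * φ (x i) := by
    intro i
    have h1 : N = (φ (x i)).den * ∏ j ∈ Finset.univ.erase i, (φ (x j)).den :=
      (Finset.mul_prod_erase _ _ (Finset.mem_univ i)).symm
    have h2 : (((φ (x i)).num.toNat : ℤ) : ℚ) = φ (x i) * (φ (x i)).den := by
      rw [Int.toNat_of_nonneg (Rat.num_nonneg.2 (hφ0 i)), Rat.mul_den_eq_num]
    rw [Int.cast_natCast] at h2
    rw [h1]
    simp only [m]
    push_cast
    rw [h2]
    ring
  have hN : (N : ℚ) ≠ 0 :=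
    Nat.cast_ne_zero.2 (Finset.prod_ne_zero_iff.2 fun i _ => (φ (x i)).den_ne_zero)
  refine ⟨(N : ℚ) • φ, m, hm, fun i => ⟨fun h => ?_, fun h => ?_⟩⟩
  · have h1 := hm i
    rw [h, Nat.cast_zero, eq_comm, mul_eq_zero] at h1
    by_contra hne
    exact (hφ i (lt_of_le_of_ne (hx i) (Ne.symm hne))).ne' (h1.resolve_left hN)
  · have h1 := hm i
    rw [h, map_zero, mul_zero] at h1
    exact_mod_cast h1

/-! ### Counting components, and the sign of the weight. -/

namespace SerreGraph

variable (G : SerreGraph.{u}) [Finite G.V]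

theorem sum_ncard_components : ∑ C ∈ (Set.toFinite G.components).toFinset, C.ncard =
    Nat.card G.V := by
  classical
  have := Fintype.ofFinite G.V
  rw [Nat.card_eq_fintype_card, ← Finset.card_univ,
    Finset.card_eq_sum_card_fiberwise (f := fun a => {b | G.Reachable a b})
      (t := (Set.toFinite G.components).toFinset)]
  · refine Finset.sum_congr rfl fun C hC => ?_
    obtain ⟨a, rfl⟩ := (Set.Finite.mem_toFinset _).1 hC
    rw [← Set.ncard_coe_finset]
    congr 1
    ext b
    simp only [Set.mem_ofPred_eq, Finset.coe_filter, Finset.mem_univ, true_and]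
    exact ⟨fun h => Set.ext fun c => ⟨h.trans, h.symm.trans⟩, fun h =>
      h.subset (Reachable.refl b : b ∈ {c | G.Reachable b c})⟩
  · intro a _
    simp only [Set.Finite.coe_toFinset]
    exact ⟨a, rfl⟩

variable {G} in
theorem two_le_ncard_of_mem_components (h : ∀ a, ∃ e, G.src e = a ∧ G.tgt e ≠ a) {C : Set G.V}
    (hC : C ∈ G.components) : 2 ≤ C.ncard := by
  obtain ⟨a, rfl⟩ := hC
  obtain ⟨e, rfl, he⟩ := h a
  exact (Set.one_lt_ncard).2 ⟨_, .refl _, _, .of_edge e, he.symm⟩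

theorem two_mul_ncard_components_le (h : ∀ a, ∃ e, G.src e = a ∧ G.tgt e ≠ a) :
    2 * G.components.ncard ≤ Nat.card G.V := by
  rw [← G.sum_ncard_components, Set.ncard_eq_toFinset_card _ (Set.toFinite _), mul_comm,
    ← smul_eq_mul]
  exact Finset.card_nsmul_le_sum _ _ _ fun C hC =>
    two_le_ncard_of_mem_components h ((Set.Finite.mem_toFinset _).1 hC)

theorem two_mul_ncard_components_lt (h : ∀ a, ∃ e, G.src e = a ∧ G.tgt e ≠ a) {a b c : G.V}
    (hb : G.Reachable a b) (hc : G.Reachable a c) (hab : a ≠ b) (hac : a ≠ c) (hbc : b ≠ c) :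
    2 * G.components.ncard < Nat.card G.V := by
  rw [← G.sum_ncard_components, Set.ncard_eq_toFinset_card _ (Set.toFinite _), mul_comm,
    ← smul_eq_mul, ← Finset.sum_const]
  refine Finset.sum_lt_sum (fun C hC =>
    two_le_ncard_of_mem_components h ((Set.Finite.mem_toFinset _).1 hC))
    ⟨{b | G.Reachable a b}, (Set.Finite.mem_toFinset _).2 ⟨a, rfl⟩, ?_⟩
  exact (Set.two_lt_ncard_iff).2 ⟨a, b, c, .refl _, hb, hc, hab, hac, hbc⟩

end SerreGraph

namespace GraphPair

variable {X : GraphPair.{u}}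

theorem Piece.exists_image_edge (P : X.Piece) (a : P.image.V) :
    ∃ e, P.image.src e = a ∧ P.image.tgt e ≠ a := by
  obtain ⟨_, d, hd, rfl⟩ := a
  exact ⟨⟨d, hd⟩, rfl, fun h => w_opp_ne d (congrArg Subtype.val h)⟩

theorem weight_nonneg (P : X.Piece) : 0 ≤ weight P := by
  have h := P.image.two_mul_ncard_components_le P.exists_image_edge
  have h' : (2 * P.image.components.ncard : ℝ) ≤ (Nat.card P.image.V : ℝ) := by exact_mod_cast h
  unfold weight
  linarith

/-- The weight sums `|C|/2 - 1` over the components `C` of the image. All terms are non-negative,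
and a component with three vertices makes one of them positive. -/
theorem weight_pos (P : X.Piece) {a b c : P.image.V} (hb : P.image.Reachable a b)
    (hc : P.image.Reachable a c) (hab : a ≠ b) (hac : a ≠ c) (hbc : b ≠ c) : 0 < weight P := by
  have h := P.image.two_mul_ncard_components_lt P.exists_image_edge hb hc hab hac hbc
  have h' : (2 * P.image.components.ncard : ℝ) < (Nat.card P.image.V : ℝ) := by exact_mod_cast h
  unfold weight
  linarith

theorem chiMinus_nonneg {x : X.PStar → ℝ} (hx : x ∈ X.cone) : 0 ≤ chiMinus x :=
  Finset.sum_nonneg fun σ _ => mul_nonneg (hx.1 σ) (weight_nonneg _)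

theorem rank_nonneg {x : X.PStar → ℝ} (hx : x ∈ X.cone) (h0 : x ≠ 0) : 0 ≤ rank x :=
  div_nonneg (chiMinus_nonneg hx) (degree_pos hx h0).le

/-! ### Linearity -/

theorem nAt_combination (ε : X.S.V) (a b : ℝ) (x y : X.PStar → ℝ) :
    nAt ε (a • x + b • y) = a * nAt ε x + b * nAt ε y := by
  simp only [nAt, Finset.mul_sum, ← Finset.sum_add_distrib, Pi.add_apply, Pi.smul_apply,
    smul_eq_mul]
  exact Finset.sum_congr rfl fun σ _ => by ring

theorem degree_combination (a b : ℝ) (x y : X.PStar → ℝ) :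
    degree (a • x + b • y) = a * degree x + b * degree y := by
  unfold degree
  split_ifs
  · exact nAt_combination _ _ _ _ _
  · simp

theorem chiMinus_combination (a b : ℝ) (x y : X.PStar → ℝ) :
    chiMinus (a • x + b • y) = a * chiMinus x + b * chiMinus y := by
  simp only [chiMinus, Finset.mul_sum, ← Finset.sum_add_distrib, Pi.add_apply, Pi.smul_apply,
    smul_eq_mul]
  exact Finset.sum_congr rfl fun σ _ => by ring

theorem combination_mem_cone {a b : ℝ} {x y : X.PStar → ℝ} (hx : x ∈ X.cone) (hy : y ∈ X.cone)
    (h : ∀ σ, 0 ≤ (a • x + b • y) σ) : a • x + b • y ∈ X.cone := by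
  refine ⟨h, fun e P Q hg => ?_, fun ε ε' => ?_⟩
  · have h1 := hx.2.1 e P Q hg
    have h2 := hy.2.1 e P Q hg
    unfold GluingEq at h1 h2 ⊢
    simp only [Pi.add_apply, Pi.smul_apply, smul_eq_mul, Finset.sum_add_distrib,
      ← Finset.mul_sum, h1, h2]
  · rw [nAt_combination, nAt_combination, hx.2.2 ε ε', hy.2.2 ε ε']

theorem smul_mem_cone {a : ℝ} (ha : 0 ≤ a) {x : X.PStar → ℝ} (hx : x ∈ X.cone) :
    a • x ∈ X.cone := by
  have h := combination_mem_cone (a := a) (b := 0) hx hx (fun σ => by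
    simpa using mul_nonneg ha (hx.1 σ))
  simpa using h

theorem degree_smul (a : ℝ) (x : X.PStar → ℝ) : degree (a • x) = a * degree x := by
  simpa using degree_combination a 0 x x

theorem chiMinus_smul (a : ℝ) (x : X.PStar → ℝ) : chiMinus (a • x) = a * chiMinus x := by
  simpa using chiMinus_combination a 0 x x

theorem continuous_nAt (ε : X.S.V) : Continuous (nAt (X := X) ε) := by
  unfold nAt
  fun_prop

theorem continuous_degree : Continuous (degree (X := X)) := by
  unfold degree
  split_ifs
  · exact continuous_nAt _
  · exact continuous_const

theorem continuous_chiMinus : Continuous (chiMinus (X := X)) := by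
  unfold chiMinus
  fun_prop

/-! ### Compactness of the slice and integral extremal vectors. -/

variable (X) in
theorem isClosed_cone : IsClosed X.cone := by
  refine IsClosed.and ?_ (IsClosed.and ?_ ?_)
  · exact isClosed_Ici (a := (0 : X.PStar → ℝ))
  · simp only [Set.ofPred_forall]
    refine isClosed_iInter fun e => isClosed_iInter fun P => isClosed_iInter fun Q =>
      isClosed_iInter fun _ => isClosed_eq ?_ ?_ <;> fun_prop
  · simp only [Set.ofPred_forall]
    exact isClosed_iInter fun ε => isClosed_iInter fun ε' =>
      isClosed_eq (continuous_nAt ε) (continuous_nAt ε')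

variable (X) in
theorem isCompact_slice : IsCompact {x | x ∈ X.cone ∧ degree x = 1} := by
  refine (isCompact_Icc (a := (0 : X.PStar → ℝ)) (b := 1)).of_isClosed_subset
    (X.isClosed_cone.and (isClosed_eq continuous_degree continuous_const)) ?_
  rintro x ⟨hx, h1⟩
  exact ⟨fun σ => hx.1 σ, fun σ => (le_degree hx σ).trans h1.le⟩

theorem normalize_mem_slice {x : X.PStar → ℝ} (hx : x ∈ X.cone) (h0 : x ≠ 0) :
    (degree x)⁻¹ • x ∈ X.cone ∧ degree ((degree x)⁻¹ • x) = 1 :=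
  ⟨smul_mem_cone (inv_nonneg.2 (degree_pos hx h0).le) hx, by
    rw [degree_smul, inv_mul_cancel₀ (degree_pos hx h0).ne']⟩

/-- A vector of the cone can be replaced by an integral one with the same support. -/
theorem exists_nat_mem_cone {x : X.PStar → ℝ} (hx : x ∈ X.cone) :
    ∃ m : X.PStar → ℕ, (fun σ => (m σ : ℝ)) ∈ X.cone ∧ ∀ σ, m σ = 0 ↔ x σ = 0 := by
  classical
  obtain ⟨ψ, m, hm, hm0⟩ := exists_nat_specialization x hx.1
  -- Both kinds of equations equate sums of coordinates, and `ψ` preserves such relations.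
  have hsum : ∀ s t : Finset X.PStar, ∑ σ ∈ s, x σ = ∑ σ ∈ t, x σ →
      ∑ σ ∈ s, (m σ : ℝ) = ∑ σ ∈ t, (m σ : ℝ) := by
    intro s t h
    have h' := congrArg ψ h
    rw [map_sum, map_sum] at h'
    simp only [← hm] at h'
    exact_mod_cast h'
  refine ⟨m, ⟨fun σ => Nat.cast_nonneg _, fun e P Q hg => hsum _ _ (hx.2.1 e P Q hg),
    fun ε ε' => ?_⟩, hm0⟩
  have h := hx.2.2 ε ε'
  rw [nAt_eq, nAt_eq] at h ⊢
  exact hsum _ _ h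

theorem exists_pos_mul_le {ι : Type*} [Finite ι] (x m : ι → ℝ) (hx : ∀ i, 0 ≤ x i)
    (hm : ∀ i, x i = 0 → m i = 0) : ∃ t, 0 < t ∧ ∀ i, t * m i ≤ x i := by
  have h : ∀ᶠ t in nhdsWithin (0 : ℝ) (Set.Ioi 0), ∀ i, t * m i ≤ x i := by
    rw [Filter.eventually_all]
    intro i
    rcases (hx i).eq_or_lt with h | h
    · filter_upwards with t
      rw [hm i h.symm, mul_zero, h]
    · have hc : Filter.Tendsto (fun t : ℝ => t * m i) (nhds 0) (nhds (0 * m i)) :=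
        (continuous_id.mul continuous_const).tendsto 0
      rw [zero_mul] at hc
      exact ((hc.eventually_lt_const h).filter_mono nhdsWithin_le_nhds).mono fun _ => le_of_lt
  obtain ⟨t, h, h0⟩ := (h.and self_mem_nhdsWithin).exists
  exact ⟨t, h0, h⟩

/-- For any sign `s`, the function `s * rank` attains its maximum at an integral vector. -/
theorem exists_nat_extremal (hC : ∃ x ∈ X.cone, x ≠ 0) (s : ℝ) :
    ∃ m : X.PStar → ℕ, (fun σ => (m σ : ℝ)) ∈ X.cone ∧ (fun σ => (m σ : ℝ)) ≠ 0 ∧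
      ∀ y ∈ X.cone, y ≠ 0 → s * rank y ≤ s * rank fun σ => (m σ : ℝ) := by
  obtain ⟨z, hz, hz0⟩ := hC
  obtain ⟨x, ⟨hx, hx1⟩, hmax⟩ := X.isCompact_slice.exists_isMaxOn
    ⟨_, normalize_mem_slice hz hz0⟩ (f := fun x => s * chiMinus x)
    (continuous_const.mul continuous_chiMinus).continuousOn
  obtain ⟨m, hm, hm0⟩ := exists_nat_mem_cone hx
  have hx0 : x ≠ 0 := by
    rintro rfl
    have := degree_smul (0 : ℝ) (0 : X.PStar → ℝ)
    rw [zero_smul, hx1, zero_mul] at this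
    exact one_ne_zero this
  have hmne : (fun σ => (m σ : ℝ)) ≠ 0 := by
    obtain ⟨σ, hσ⟩ := Function.ne_iff.1 hx0
    exact Function.ne_iff.2 ⟨σ, fun h => hσ ((hm0 σ).1 (Nat.cast_eq_zero.1 h))⟩
  have hle : ∀ y ∈ X.cone, y ≠ 0 → s * rank y ≤ s * chiMinus x := by
    intro y hy hy0
    refine le_of_eq_of_le ?_ (hmax (normalize_mem_slice hy hy0))
    beta_reduce
    rw [chiMinus_smul, rank, div_eq_inv_mul]
  -- Clearing the denominator gives a linear inequality that includes `y = 0`; the vector `x - t m`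
  -- used below may be zero.
  have hle' : ∀ y ∈ X.cone, s * chiMinus y ≤ s * chiMinus x * degree y := by
    intro y hy
    by_cases hy0 : y = 0
    · subst hy0
      have h1 := chiMinus_smul (0 : ℝ) (0 : X.PStar → ℝ)
      have h2 := degree_smul (0 : ℝ) (0 : X.PStar → ℝ)
      rw [zero_smul, zero_mul] at h1 h2
      rw [h1, h2, mul_zero, mul_zero]
    · have h := hle y hy hy0
      rw [rank, ← mul_div_assoc, div_le_iff₀ (degree_pos hy hy0)] at h
      exact h
  obtain ⟨t, ht, htm⟩ := exists_pos_mul_le x (fun σ => (m σ : ℝ)) hx.1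
    (fun σ h => Nat.cast_eq_zero.2 ((hm0 σ).2 h))
  refine ⟨m, hm, hmne, fun y hy hy0 => (hle y hy hy0).trans ?_⟩
  -- With `c = s * chiMinus x`, the bound at `x - t m` reads `c - t s χ₋(m) ≤ c (1 - t n(m))`, so `c
  -- n(m) ≤ s χ₋(m)`: the integral vector is extremal too.
  have h := hle' _ (combination_mem_cone (a := 1) (b := -t) hx hm (fun σ => by
    have := htm σ
    simp only [Pi.add_apply, Pi.smul_apply, smul_eq_mul]
    linarith))
  rw [chiMinus_combination, degree_combination, hx1] at h
  rw [rank, ← mul_div_assoc, le_div_iff₀ (degree_pos hm hmne)]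
  have h' : t * (s * chiMinus x * degree fun σ => (m σ : ℝ)) ≤
      t * (s * chiMinus fun σ => (m σ : ℝ)) := by linarith
  exact le_of_mul_le_mul_left h' ht

theorem exists_rat_eq_rank (m : X.PStar → ℕ) : ∃ q : ℚ, (q : ℝ) = rank fun σ => (m σ : ℝ) := by
  classical
  have h1 : ∃ q : ℚ, (q : ℝ) = chiMinus fun σ => (m σ : ℝ) := by
    refine ⟨∑ σ, (m σ : ℚ) * ((Nat.card σ.center.image.V : ℚ) / 2 -
      (σ.center.image.components.ncard : ℚ)), ?_⟩
    simp only [chiMinus, weight]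
    push_cast
    rfl
  have h2 : ∃ q : ℚ, (q : ℝ) = degree fun σ => (m σ : ℝ) := by
    unfold degree
    split_ifs with h
    · rw [nAt_eq]
      exact ⟨((∑ σ with ∃ d, X.S.src d = h.some ∧
        PrePiece.rel σ.center.toPrePiece d d, m σ : ℕ) : ℚ), by push_cast; rfl⟩
    · exact ⟨0, Rat.cast_zero⟩
  obtain ⟨q, hq⟩ := h1
  obtain ⟨r, hr⟩ := h2
  exact ⟨q / r, by rw [rank, ← hq, ← hr, Rat.cast_div]⟩

end GraphPair

/-! ### Vectors of rank zero and parallel cycles. -/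

namespace GraphPair

variable {X : GraphPair.{u}}

namespace Piece

/-- The vertices of an irreducible graph have valence at least two. -/
theorem exists_rel_ne (P : X.Piece) {d : X.S.E} (hd : P.rel d d) : ∃ d', P.rel d d' ∧ d' ≠ d := by
  let e : P.graph.E := ⟨d, hd⟩
  let A := {a | P.graph.Reachable (P.graph.src e) a}
  by_contra! h
  refine (P.irreducible (P.graph.src e)).2.2.1 ⟨P.graph.src e, .refl _⟩
    (Set.ncard_eq_one.2 ⟨(⟨e, .refl _, .of_edge e⟩ : (P.graph.induce A).E), ?_⟩)
  ext e'
  simp only [SerreGraph.star, Set.mem_ofPred_eq, Set.mem_singleton_iff]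
  constructor
  · intro he
    exact Subtype.ext (Subtype.ext (h _ (P.symm (Quotient.exact (congrArg Subtype.val he)))))
  · rintro rfl
    rfl

/-- If the components of the image of `P` have two vertices, then edges of the image that start at
the same vertex end at the same vertex. -/
theorem w_opp_eq_of_weight_eq_zero (P : X.Piece) (h0 : weight P = 0) {d d' : X.S.E}
    (hd : P.rel d d) (hd' : P.rel d' d') (h : X.w.onE d = X.w.onE d') :
    X.w.onE (X.opp d) = X.w.onE (X.opp d') := by
  -- Otherwise the common origin and the two ends are three vertices of one component.
  by_contra hne
  let e : P.image.E := ⟨d, hd⟩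
  let e' : P.image.E := ⟨d', hd'⟩
  have hs : P.image.src e = P.image.src e' := Subtype.ext h
  have he' := Reachable.of_edge e'
  rw [← hs] at he'
  exact (weight_pos P (Reachable.of_edge e) he'
    (fun h => w_opp_ne d (congrArg Subtype.val h).symm)
    (fun h' => w_opp_ne d' ((congrArg Subtype.val h').symm.trans h))
    (fun h => hne (congrArg Subtype.val h))).ne' h0

end Piece

/-- One side of the gluing equation contains `x σ > 0`, so the other side has a positive term. The
support of `x` can thus be followed along edge paths. -/
theorem exists_center_eq_nbr {x : X.PStar → ℝ} (hx : x ∈ X.cone) {σ : X.PStar} (hσ : 0 < x σ)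
    (e : {e // e ∈ σ.center.support}) : ∃ τ, 0 < x τ ∧ τ.center = σ.nbr e := by
  classical
  have hg := hx.2.1 _ _ _ (σ.glue e)
  unfold GluingEq at hg
  have hpos : 0 < ∑ τ : X.PStar with τ.center = σ.center ∧ τ.LabelEq e.1 (σ.nbr e), x τ :=
    hσ.trans_le (Finset.single_le_sum (f := x) (fun τ _ => hx.1 τ)
      (by simpa using ⟨e.2, rfl⟩))
  rw [hg] at hpos
  obtain ⟨τ, hτ, hτ0⟩ := Finset.exists_lt_of_sum_lt (Finset.sum_const_zero.trans_lt hpos)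
  exact ⟨τ, hτ0, (Finset.mem_filter.1 hτ).2.1⟩

theorem weight_eq_zero_of_chiMinus_eq_zero {x : X.PStar → ℝ} (hx : x ∈ X.cone)
    (h : chiMinus x = 0) {σ : X.PStar} (hσ : 0 < x σ) : weight σ.center = 0 := by
  have := (Finset.sum_eq_zero_iff_of_nonneg fun σ _ =>
    mul_nonneg (hx.1 σ) (weight_nonneg σ.center)).1 h σ (Finset.mem_univ σ)
  exact (mul_eq_zero.1 this).resolve_left hσ.ne'

/-- Vectors of rank zero correspond to annuli, so every cycle is parallel to another one. -/
theorem chiMinus_pos_of_hasIsolatedCycle (hX : X.HasIsolatedCycle) {x : X.PStar → ℝ}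
    (hx : x ∈ X.cone) (h0 : x ≠ 0) : 0 < chiMinus x := by
  classical
  refine lt_of_le_of_ne (chiMinus_nonneg hx) fun hchi => ?_
  have hw : ∀ σ, 0 < x σ → weight σ.center = 0 := fun σ =>
    weight_eq_zero_of_chiMinus_eq_zero hx hchi.symm
  obtain ⟨d, hd⟩ := hX
  have hdeg := degree_pos hx h0
  rw [← degree_eq hx (X.S.src d), nAt_eq] at hdeg
  obtain ⟨σ, hσ, hσ0⟩ := Finset.exists_lt_of_sum_lt (Finset.sum_const_zero.trans_lt hdeg)
  have hmem := (σ.center.exists_src_iff d).1 (Finset.mem_filter.1 hσ).2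
  obtain ⟨d', hrel, hne⟩ := σ.center.exists_rel_ne hmem
  -- Having a common origin in the piece need not survive `opp`. The invariant only keeps both
  -- strands in one piece over a common vertex of its image, which suffices when the weights vanish.
  have key : ∀ k : ℕ, ∃ τ, 0 < x τ ∧ τ.center.rel (X.next^[k] d) (X.next^[k] d) ∧
      τ.center.rel (X.next^[k] d') (X.next^[k] d') ∧
      X.w.onE (X.next^[k] d) = X.w.onE (X.next^[k] d') := by
    intro k
    induction k with
    | zero => exact ⟨σ, hσ0, hmem, σ.center.rel_right hrel, σ.center.onE_eq hrel⟩
    | succ k ih =>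
      rw [Function.iterate_succ_apply', Function.iterate_succ_apply']
      generalize X.next^[k] d = a at ih ⊢
      generalize X.next^[k] d' = b at ih ⊢
      obtain ⟨τ, hτ, ha, hb, hab⟩ := ih
      let e : {e // e ∈ τ.center.support} := ⟨X.w.onE a, a, ha, rfl⟩
      obtain ⟨υ, hυ, hc⟩ := exists_center_eq_nbr hx hτ e
      have ha' := ((τ.glue e).2.2 a a rfl rfl).1 ha
      have hb' := ((τ.glue e).2.2 b b hab.symm hab.symm).1 hb
      rw [← hc] at ha' hb'
      refine ⟨υ, hυ, υ.center.opp_mem ha', υ.center.opp_mem hb',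
        υ.center.w_opp_eq_of_weight_eq_zero (hw υ hυ) ha' hb' ?_⟩
      rw [← X.w.bar_onE, ← X.w.bar_onE, hab]
  exact hne (hd d' fun k => (key k).choose_spec.2.2.2.symm)

end GraphPair

/-! ### From `∂`-immersions to vectors of the cone. -/

namespace GraphPair

variable {X : GraphPair.{u}}

theorem Hom.onS_opp {Y : GraphPair.{u}} (f : Y.Hom X) (d : Y.S.E) :
    X.opp (f.onS.onE d) = f.onS.onE (Y.opp d) := by
  refine opp_eq ?_ fun h => Y.opp_ne d (f.immersion_onS _ (Y.src_opp d) rfl h)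
  rw [f.onS.src_onE, f.onS.src_onE, Y.src_opp]

theorem nontrivial_star (x : X.Γ.V) (h : (X.whAt x).Connected) : Nontrivial (X.whAt x).V := by
  obtain ⟨⟨e, he⟩⟩ := h.1
  have h0 : (X.Γ.star x).ncard ≠ 0 := (Set.ncard_pos (Set.toFinite _)).2 ⟨e, he⟩ |>.ne'
  have h1 := X.valence_ne_one x
  obtain ⟨a, ha, b, hb, hab⟩ := (Set.one_lt_ncard).1 (by omega : 1 < (X.Γ.star x).ncard)
  exact ⟨⟨⟨a, ha⟩, ⟨b, hb⟩, fun h => hab (congrArg Subtype.val h)⟩⟩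

namespace BdryImmersion

variable {L D : GraphPair.{u}} (F : BdryImmersion L D X)

/-- The vertex of `Δ` from which the image of an oriented edge of the multicycle starts. -/
def vertex (d : L.S.E) : D.Γ.V := F.fst.onΓ.onV (L.Γ.src (L.w.onE d))

theorem src_w_onS (d : L.S.E) : D.Γ.src (D.w.onE (F.fst.onS.onE d)) = F.vertex d := by
  rw [F.fst.commE, F.fst.onΓ.src_onE]
  rfl

theorem vertex_opp (d : L.S.E) : F.vertex (L.opp d) = F.vertex d := by
  unfold vertex
  rw [L.w.src_onE, L.w.src_onE, L.src_opp]

theorem vertex_bar (d : L.S.E) :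
    F.vertex (L.S.bar d) = D.Γ.tgt (D.w.onE (F.fst.onS.onE d)) := by
  rw [← src_w_onS, ← F.fst.onS.bar_onE, ← D.w.bar_onE]
  rfl

theorem sE_opp (d : L.S.E) : F.sE (L.opp d) = X.opp (F.sE d) := by
  unfold sE
  rw [F.snd.onS_opp, F.fst.onS_opp]

theorem sE_bar (d : L.S.E) : F.sE (L.S.bar d) = X.S.bar (F.sE d) := by
  unfold sE
  rw [F.snd.onS.bar_onE, F.fst.onS.bar_onE]

theorem w_sE (d : L.S.E) : X.w.onE (F.sE d) = F.snd.onΓ.onE (D.w.onE (F.fst.onS.onE d)) :=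
  F.snd.commE _

theorem w_sE' (d : L.S.E) : X.w.onE (F.sE d) = F.snd.onΓ.onE (F.fst.onΓ.onE (L.w.onE d)) := by
  rw [w_sE, F.fst.commE]

/-- `Δ → Γ` is injective on stars, which recovers the edge of `Δ`; then `snd` being an immersion of
pairs recovers the edge of the multicycle. Hence the piece at a vertex of `Δ` is bijective on edges.
-/
theorem eq_of_sE_eq {d d' : L.S.E} (h : F.sE d = F.sE d') (hx : F.vertex d = F.vertex d') :
    d = d' := by
  refine F.bijE.1 (F.snd_immersion.2.2 _ _ ?_ h)
  refine F.snd_immersion.1 (F.vertex d) (F.src_w_onS d) ((F.src_w_onS d').trans hx.symm) ?_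
  rw [← w_sE, ← w_sE, h]

theorem vertex_eq_of_w_eq {d d' : L.S.E} (h : L.w.onE d = L.w.onE d') :
    F.vertex d = F.vertex d' := by
  unfold vertex
  rw [h]

/-- The disjoint union of the Whitehead graphs of `u` over the vertex `x` of `Δ`. -/
def prePieceAt (x : D.Γ.V) : X.PrePiece where
  rel a b := ∃ d d', F.sE d = a ∧ F.sE d' = b ∧ L.w.onE d = L.w.onE d' ∧ F.vertex d = x
  symm := by
    rintro _ _ ⟨d, d', rfl, rfl, h, rfl⟩
    exact ⟨d', d, rfl, rfl, h.symm, (F.vertex_eq_of_w_eq h).symm⟩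
  trans := by
    rintro _ _ _ ⟨d, d', rfl, rfl, h, rfl⟩ ⟨c, c', hc, rfl, h', hx⟩
    obtain rfl := F.eq_of_sE_eq hc (hx.trans (F.vertex_eq_of_w_eq h))
    exact ⟨d, c', rfl, rfl, h.trans h', rfl⟩
  opp_mem := by
    rintro _ ⟨d, _, rfl, _, _, rfl⟩
    exact ⟨L.opp d, L.opp d, F.sE_opp d, F.sE_opp d, rfl, F.vertex_opp d⟩
  onE_eq := by
    rintro _ _ ⟨d, d', rfl, rfl, h, rfl⟩
    rw [w_sE', w_sE', h]

variable {F} in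
theorem prePieceAt_rel_iff {x : D.Γ.V} {d d' : L.S.E} (hd : F.vertex d = x)
    (hd' : F.vertex d' = x) :
    (F.prePieceAt x).rel (F.sE d) (F.sE d') ↔ L.w.onE d = L.w.onE d' := by
  constructor
  · rintro ⟨c, c', hc, hc', h, hx⟩
    obtain rfl := F.eq_of_sE_eq hc (hx.trans hd.symm)
    obtain rfl := F.eq_of_sE_eq hc' ((F.vertex_eq_of_w_eq h).symm.trans (hx.trans hd'.symm))
    exact h
  · intro h
    exact ⟨d, d', rfl, rfl, h, hd⟩

variable {F} in
theorem prePieceAt_mem_iff {x : D.Γ.V} {a : X.S.E} :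
    (F.prePieceAt x).rel a a ↔ ∃ d, F.sE d = a ∧ F.vertex d = x := by
  constructor
  · rintro ⟨d, -, h, -, -, hx⟩
    exact ⟨d, h, hx⟩
  · rintro ⟨d, rfl, rfl⟩
    exact ⟨d, d, rfl, rfl, rfl, rfl⟩

theorem prePieceAt_irreducible (hL : L.LocallyIrreducible) (x : D.Γ.V) :
    (F.prePieceAt x).graph.IsUnionOfIrreducibles := by
  rintro ⟨⟨_, ha⟩⟩
  obtain ⟨d, rfl, rfl⟩ := prePieceAt_mem_iff.1 ha
  let x' := L.Γ.src (L.w.onE d)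
  have hx' := hL x'
  have := hx'.2.1
  have hv : ∀ c : (L.whAt x').E, F.vertex c.1 = F.vertex d := fun c =>
    congrArg F.fst.onΓ.onV c.2.1
  -- Vertices of a piece are classes of oriented edges, so mapping a vertex of `Wh_x'(u)` needs an
  -- edge issuing from it.
  choose s hs using hx'.1.exists_src_eq
  have hs' : ∀ e, L.w.onE (s e).1 = e.1 := fun e => congrArg Subtype.val (hs e)
  let G := (F.prePieceAt (F.vertex d)).graph
  let f : (L.whAt x').Hom G :=
    { onV := fun e => Quotient.mk _ ⟨F.sE (s e).1, prePieceAt_mem_iff.2 ⟨_, rfl, hv (s e)⟩⟩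
      onE := fun c => ⟨F.sE c.1, prePieceAt_mem_iff.2 ⟨_, rfl, hv c⟩⟩
      src_onE := fun c => Quotient.sound ((prePieceAt_rel_iff (hv _) (hv _)).2
        (hs' ((L.whAt x').src c)).symm)
      bar_onE := fun c => Subtype.ext (F.sE_opp c.1).symm }
  have key := f.irreducible_component ?_ ?_ ?_ hx' ⟨L.w.onE d, rfl⟩
  · have h : f.onV ⟨L.w.onE d, rfl⟩ = Quotient.mk _ ⟨F.sE d, ha⟩ :=
      Quotient.sound ((prePieceAt_rel_iff (hv _) rfl).2 (hs' _))
    rw [h] at key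
    exact key
  · intro e e' h
    have := (prePieceAt_rel_iff (hv _) (hv _)).1 (Quotient.exact h)
    rw [hs', hs'] at this
    exact Subtype.ext this
  · intro c c' h
    exact Subtype.ext (F.eq_of_sE_eq (congrArg Subtype.val h) ((hv c).trans (hv c').symm))
  · rintro e ⟨_, hb⟩ h
    obtain ⟨c, rfl, hc⟩ := prePieceAt_mem_iff.1 hb
    have hce := (prePieceAt_rel_iff hc (hv _)).1 (Quotient.exact h)
    rw [hs'] at hce
    have h1 : L.Γ.src (L.w.onE c) = x' := by rw [hce]; exact e.2
    refine ⟨⟨c, h1, ?_⟩, rfl⟩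
    change L.Γ.src (L.w.onE (L.opp c)) = x'
    rw [L.w.src_onE, L.src_opp, ← L.w.src_onE, h1]

/-- The projection of the Whitehead graphs of `v`. -/
def whHom (x : D.Γ.V) : (D.whAt x).Hom X.wh where
  onV e := F.snd.onΓ.onE e.1
  onE c := F.snd.onS.onE c.1
  src_onE c := F.snd.commE c.1
  bar_onE c := F.snd.onS_opp c.1

variable {F}

/-- A connected Whitehead graph with at least two vertices has no isolated vertex, so the multicycle
traverses every edge of `Δ`. -/
theorem exists_lift (hD : ∀ x, (D.whAt x).Connected) (e : D.Γ.E) :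
    ∃ d, D.w.onE (F.fst.onS.onE d) = e := by
  have := nontrivial_star _ (hD (D.Γ.src e))
  obtain ⟨c, hc⟩ := (hD (D.Γ.src e)).exists_src_eq ⟨e, rfl⟩
  obtain ⟨d, hd⟩ := F.bijE.2 c.1
  exact ⟨d, by rw [hd]; exact congrArg Subtype.val hc⟩

theorem exists_vertex_eq (hD : ∀ x, (D.whAt x).Connected) (x : D.Γ.V) :
    ∃ d, F.vertex d = x := by
  obtain ⟨⟨e, rfl⟩⟩ := (hD x).1
  obtain ⟨d, rfl⟩ := F.exists_lift hD e
  exact ⟨d, (F.src_w_onS d).symm⟩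

theorem mem_support_prePieceAt (hD : ∀ x, (D.whAt x).Connected) {x : D.Γ.V} {e : X.Γ.E} :
    e ∈ (F.prePieceAt x).support ↔ ∃ a, D.Γ.src a = x ∧ F.snd.onΓ.onE a = e := by
  constructor
  · rintro ⟨_, h, rfl⟩
    obtain ⟨d, rfl, rfl⟩ := prePieceAt_mem_iff.1 h
    exact ⟨_, F.src_w_onS d, (F.w_sE d).symm⟩
  · rintro ⟨a, rfl, rfl⟩
    obtain ⟨d, rfl⟩ := F.exists_lift hD a
    exact ⟨F.sE d, prePieceAt_mem_iff.2 ⟨d, rfl, (F.src_w_onS d).symm⟩, F.w_sE d⟩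

/-- The piece of the vertex `x` of `Δ`. -/
def pieceAt (hL : L.LocallyIrreducible) (hD : ∀ x, (D.whAt x).Connected) (F : BdryImmersion L D X)
    (x : D.Γ.V) : X.Piece where
  toPrePiece := F.prePieceAt x
  nonempty := by
    obtain ⟨d, hd⟩ := F.exists_vertex_eq hD x
    exact ⟨F.sE d, prePieceAt_mem_iff.2 ⟨d, rfl, hd⟩⟩
  one_component := by
    intro a b ha hb
    obtain ⟨d, rfl, hd⟩ := prePieceAt_mem_iff.1 ha
    obtain ⟨d', rfl, hd'⟩ := prePieceAt_mem_iff.1 hb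
    rw [F.w_sE, F.w_sE]
    exact ((hD x).2 ⟨_, (F.src_w_onS d).trans hd⟩ ⟨_, (F.src_w_onS d').trans hd'⟩).map (F.whHom x)
  irreducible := F.prePieceAt_irreducible hL x

variable (hL : L.LocallyIrreducible) (hD : ∀ x, (D.whAt x).Connected)

theorem isPieceAt_iff (x : D.Γ.V) (P : X.Piece) : F.IsPieceAt x P ↔ P = F.pieceAt hL hD x := by
  constructor
  · intro h
    exact Piece.ext_rel h
  · rintro rfl a b
    rfl

/-- One direction of the gluing condition; the other is the same statement for the reversed edge. -/
theorem pieceAt_rel_bar (a : D.Γ.E) {d d' : X.S.E} (h : X.w.onE d = F.snd.onΓ.onE a)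
    (hr : (F.pieceAt hL hD (D.Γ.src a)).rel d d') :
    (F.pieceAt hL hD (D.Γ.tgt a)).rel (X.S.bar d) (X.S.bar d') := by
  obtain ⟨c, c', rfl, rfl, hw, hx⟩ := hr
  refine ⟨L.S.bar c, L.S.bar c', F.sE_bar c, F.sE_bar c', ?_, ?_⟩
  · rw [← L.w.bar_onE, ← L.w.bar_onE, hw]
  · rw [vertex_bar]
    congr 1
    exact F.snd_immersion.1 (D.Γ.src a) ((F.src_w_onS c).trans hx) rfl ((F.w_sE c).symm.trans h)

theorem glue_pieceAt (a : D.Γ.E) : Piece.Glue (F.snd.onΓ.onE a) (F.pieceAt hL hD (D.Γ.src a))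
    (F.pieceAt hL hD (D.Γ.tgt a)) := by
  refine ⟨(mem_support_prePieceAt hD).2 ⟨a, rfl, rfl⟩,
    (mem_support_prePieceAt hD).2 ⟨D.Γ.bar a, rfl, (F.snd.onΓ.bar_onE a).symm⟩,
    fun d d' hd _ => ⟨F.pieceAt_rel_bar hL hD a hd, fun h => ?_⟩⟩
  have := F.pieceAt_rel_bar hL hD (D.Γ.bar a) (d := X.S.bar d) (d' := X.S.bar d')
    (by rw [← X.w.bar_onE, hd, F.snd.onΓ.bar_onE]) h
  rwa [tgt_bar, X.S.bar_bar, X.S.bar_bar] at this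

/-- The `𝒫`-star of the vertex `x` of `Δ`. -/
def starAt (F : BdryImmersion L D X) (x : D.Γ.V) : X.PStar where
  center := F.pieceAt hL hD x
  nbr e := F.pieceAt hL hD (D.Γ.tgt ((mem_support_prePieceAt hD).1 e.2).choose)
  glue e := by
    obtain ⟨h1, h2⟩ := ((mem_support_prePieceAt hD).1 e.2).choose_spec
    have := F.glue_pieceAt hL hD ((mem_support_prePieceAt hD).1 e.2).choose
    rwa [h1, h2] at this

/-- The edge of `Δ` chosen in `starAt` is unique, by injectivity on stars. -/
theorem labelEq_starAt_iff (a : D.Γ.E) (Q : X.Piece) :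
    (F.starAt hL hD (D.Γ.src a)).LabelEq (F.snd.onΓ.onE a) Q ↔
      F.pieceAt hL hD (D.Γ.tgt a) = Q := by
  have hmem : F.snd.onΓ.onE a ∈ (F.prePieceAt (D.Γ.src a)).support :=
    (mem_support_prePieceAt hD).2 ⟨a, rfl, rfl⟩
  obtain ⟨h1, h2⟩ := ((mem_support_prePieceAt hD).1 hmem).choose_spec
  have h : (F.starAt hL hD (D.Γ.src a)).nbr ⟨F.snd.onΓ.onE a, hmem⟩ =
      F.pieceAt hL hD (D.Γ.tgt a) := by
    change F.pieceAt hL hD (D.Γ.tgt ((mem_support_prePieceAt hD).1 hmem).choose) = _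
    rw [F.snd_immersion.1 (D.Γ.src a) h1 rfl h2]
  rw [← h]
  exact ⟨fun ⟨_, h⟩ => h, fun h => ⟨hmem, h⟩⟩

theorem isStarAt_iff (x : D.Γ.V) (σ : X.PStar) : F.IsStarAt x σ ↔ F.starAt hL hD x = σ := by
  constructor
  · rintro ⟨h1, h2⟩
    rw [isPieceAt_iff hL hD] at h1
    obtain ⟨c, n, g⟩ := σ
    obtain rfl : c = F.pieceAt hL hD x := h1
    unfold starAt
    congr 1
    funext e
    obtain ⟨h3, h4⟩ := ((mem_support_prePieceAt hD).1 e.2).choose_spec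
    obtain ⟨Q, hQ, _, hQ'⟩ := h2 _ h3
    rw [isPieceAt_iff hL hD] at hQ
    rw [← hQ, ← hQ']
    congr 1
    exact Subtype.ext h4
  · rintro rfl
    refine ⟨(isPieceAt_iff hL hD x _).2 rfl, ?_⟩
    rintro a rfl
    exact ⟨_, (isPieceAt_iff hL hD _ _).2 rfl, (F.labelEq_starAt_iff hL hD a _).2 rfl⟩

theorem sum_piVec (p : X.PStar → Prop) [DecidablePred p] :
    ∑ σ with p σ, F.piVec σ = ({x | p (F.starAt hL hD x)}.ncard : ℝ) := by
  classical
  have := Fintype.ofFinite D.Γ.V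
  have h : ∀ σ, F.piVec σ = (({x | F.starAt hL hD x = σ} : Finset D.Γ.V).card : ℝ) := by
    intro σ
    rw [piVec, ← Set.ncard_coe_finset]
    congr 2
    ext x
    simp [F.isStarAt_iff hL hD x σ]
  simp only [h]
  rw [← Nat.cast_sum, Nat.cast_inj, Set.ncard_eq_toFinset_card', Finset.card_eq_sum_card_fiberwise
    (f := F.starAt hL hD) (t := ({σ | p σ} : Finset X.PStar)) (by intro x; simp)]
  refine Finset.sum_congr rfl fun σ hσ => congrArg Finset.card ?_
  ext x
  simp only [Finset.mem_filter, Finset.mem_univ, true_and, Set.mem_toFinset, Set.mem_ofPred_eq]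
    at hσ ⊢
  constructor
  · rintro rfl
    exact ⟨hσ, rfl⟩
  · exact fun h => h.2

/-- Each side counts edges of `Δ` over `e` or `bar e` with prescribed pieces at their ends, and
reversal exchanges the two sets. -/
theorem gluingEq_piVec (hL : L.LocallyIrreducible)
    (hD : ∀ x, (D.whAt x).Connected) (e : X.Γ.E) (P Q : X.Piece) : GluingEq F.piVec e P Q := by
  classical
  have h : ∀ e P Q, ∑ σ : X.PStar with σ.center = P ∧ σ.LabelEq e Q, F.piVec σ =
      ({a | F.snd.onΓ.onE a = e ∧ F.pieceAt hL hD (D.Γ.src a) = P ∧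
        F.pieceAt hL hD (D.Γ.tgt a) = Q}.ncard : ℝ) := by
    intro e P Q
    rw [F.sum_piVec hL hD, Nat.cast_inj]
    symm
    refine Set.ncard_congr (fun a _ => D.Γ.src a) ?_ ?_ ?_
    · rintro a ⟨rfl, h1, h2⟩
      exact ⟨h1, (F.labelEq_starAt_iff hL hD a Q).2 h2⟩
    · rintro a b ⟨ha, -⟩ ⟨hb, -⟩ hab
      exact F.snd_immersion.1 _ rfl hab.symm (ha.trans hb.symm)
    · rintro x ⟨h1, h2⟩
      obtain ⟨a, rfl, rfl⟩ := (mem_support_prePieceAt hD).1 h2.choose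
      exact ⟨a, ⟨rfl, h1, (F.labelEq_starAt_iff hL hD a Q).1 h2⟩, rfl⟩
  unfold GluingEq
  rw [h, h, Nat.cast_inj]
  refine Set.ncard_congr (fun a _ => D.Γ.bar a) ?_ (fun _ _ _ _ h => bar_injective h) ?_
  · rintro a ⟨rfl, h1, h2⟩
    exact ⟨(F.snd.onΓ.bar_onE a).symm, h2, by rw [tgt_bar]; exact h1⟩
  · rintro a ⟨h0, h1, h2⟩
    exact ⟨D.Γ.bar a, ⟨by rw [← F.snd.onΓ.bar_onE, h0, X.Γ.bar_bar], h2, by rw [tgt_bar]; exact h1⟩,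
      D.Γ.bar_bar a⟩

/-- Points of the multicycle over `ε` correspond to the vertices of `Δ` beneath them, since `snd` is
an immersion of pairs. -/
theorem nAt_piVec (hL : L.LocallyIrreducible) (hD : ∀ x, (D.whAt x).Connected) (ε : X.S.V) :
    nAt ε F.piVec = ({q | F.sV q = ε}.ncard : ℝ) := by
  classical
  have hv : ∀ d, F.fst.onΓ.onV (L.w.onV (L.S.src d)) = F.vertex d := fun d =>
    congrArg F.fst.onΓ.onV (L.w.src_onE d).symm
  have hs : ∀ d, F.sV (L.S.src d) = X.S.src (F.sE d) := fun d => by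
    unfold sV sE
    rw [F.snd.onS.src_onE, F.fst.onS.src_onE]
  rw [nAt_eq, F.sum_piVec hL hD, Nat.cast_inj]
  symm
  refine Set.ncard_congr (fun q _ => F.fst.onΓ.onV (L.w.onV q)) ?_ ?_ ?_
  · rintro q rfl
    obtain ⟨d, rfl⟩ := exists_src_eq q
    exact ⟨F.sE d, (hs d).symm, prePieceAt_mem_iff.2 ⟨d, rfl, (hv d).symm⟩⟩
  · rintro q q' hq hq' h
    refine F.bijV.1 (F.snd_immersion.2.1 _ _ ?_ (Eq.trans hq (Eq.symm hq')))
    rw [F.fst.commV, F.fst.commV, h]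
  · rintro x ⟨_, h, h'⟩
    obtain ⟨d, rfl, rfl⟩ := prePieceAt_mem_iff.1 h'
    exact ⟨L.S.src d, (hs d).trans h, hv d⟩

theorem piVec_mem_cone (hL : L.LocallyIrreducible) (hD : ∀ x, (D.whAt x).Connected)
    (hF : F.Admissible) : F.piVec ∈ X.cone := by
  obtain ⟨n, -, hn, -⟩ := hF
  exact ⟨fun _ => Nat.cast_nonneg _, fun e P Q _ => F.gluingEq_piVec hL hD e P Q,
    fun ε ε' => by rw [F.nAt_piVec hL hD, F.nAt_piVec hL hD, hn, hn]⟩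

theorem piVec_starAt_pos (x : D.Γ.V) : 0 < F.piVec (F.starAt hL hD x) :=
  Nat.cast_pos.2 ((Set.ncard_pos (Set.toFinite _)).2 ⟨x, (F.isStarAt_iff hL hD x _).2 rfl⟩)

/-- The connected graph `Wh_x(v)` embeds in the image of the piece, which puts three vertices into
one component. -/
theorem weight_pieceAt_pos {x : D.Γ.V} (hx : 3 ≤ (D.Γ.star x).ncard) :
    0 < weight (F.pieceAt hL hD x) := by
  let f : (D.whAt x).Hom (F.pieceAt hL hD x).image :=
    { onV := fun e => ⟨F.snd.onΓ.onE e.1, (mem_support_prePieceAt hD).2 ⟨e.1, e.2, rfl⟩⟩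
      onE := fun c => ⟨F.snd.onS.onE c.1, by
        obtain ⟨c, hc, hc'⟩ := c
        obtain ⟨d, rfl⟩ := F.bijE.2 c
        exact prePieceAt_mem_iff.2 ⟨d, rfl, (F.src_w_onS d).symm.trans hc⟩⟩
      src_onE := fun c => Subtype.ext (F.snd.commE c.1)
      bar_onE := fun c => Subtype.ext (F.snd.onS_opp c.1) }
  have hf : Function.Injective f.onV := fun a b h =>
    Subtype.ext (F.snd_immersion.1 x a.2 b.2 (congrArg Subtype.val h))
  obtain ⟨a, b, c, ha, hb, hc, hab, hac, hbc⟩ := (Set.two_lt_ncard_iff).1 hx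
  have hr := fun u v => ((hD x).2 u v).map f
  exact weight_pos _ (hr ⟨a, ha⟩ ⟨b, hb⟩) (hr ⟨a, ha⟩ ⟨c, hc⟩)
    (fun h => hab (congrArg Subtype.val (hf h))) (fun h => hac (congrArg Subtype.val (hf h)))
    (fun h => hbc (congrArg Subtype.val (hf h)))

theorem chiMinus_piVec_pos (hL : L.LocallyIrreducible) (hD : ∀ x, (D.whAt x).Connected)
    {x : D.Γ.V} (hx : 3 ≤ (D.Γ.star x).ncard) : 0 < chiMinus F.piVec :=
  Finset.sum_pos' (fun _ _ => mul_nonneg (Nat.cast_nonneg _) (weight_nonneg _))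
    ⟨F.starAt hL hD x, Finset.mem_univ _,
      mul_pos (F.piVec_starAt_pos hL hD x) (F.weight_pieceAt_pos hL hD hx)⟩

end BdryImmersion

end GraphPair

end

theorem mainTheorem4 (X : GraphPair.{u}) (hC : ∃ x ∈ X.cone, x ≠ 0) :
    -- the rank is well defined on the projectivized cone
    (∀ x ∈ X.cone, x ≠ 0 → 0 < GraphPair.degree x ∧ ∀ ε, GraphPair.nAt ε x = GraphPair.degree x) ∧
    -- the maximum and the minimum are attained
    IsGreatest X.rankValues X.maxRank ∧ IsLeast X.rankValues X.minRank ∧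
    -- and realized by boundary immersions
    (∃ (L D : GraphPair.{u}) (F : GraphPair.BdryImmersion L D X), F.Realizes X.maxRank) ∧
    (∃ (L D : GraphPair.{u}) (F : GraphPair.BdryImmersion L D X), F.Realizes X.minRank) ∧
    -- they are non-negative rational numbers
    (∃ q : ℚ, 0 ≤ q ∧ (q : ℝ) = X.maxRank) ∧
    (∃ q : ℚ, 0 ≤ q ∧ (q : ℝ) = X.minRank) ∧
    -- both are positive if some cycle is not parallel to another one
    (X.HasIsolatedCycle → 0 < X.minRank ∧ 0 < X.maxRank) ∧
    -- the maximum is positive if some boundary immersion is not made of annuli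
    ((∃ (L D : GraphPair.{u}) (F : GraphPair.BdryImmersion L D X),
        L.LocallyIrreducible ∧ F.Admissible ∧ (∀ x, (D.whAt x).Connected) ∧
        ∃ x, 3 ≤ (D.Γ.star x).ncard) → 0 < X.maxRank) := by
  obtain ⟨m, hm, hm0, hmax⟩ := GraphPair.exists_nat_extremal hC 1
  -- The sign `-1` turns the maximum into the minimum.
  obtain ⟨l, hl, hl0, hmin⟩ := GraphPair.exists_nat_extremal hC (-1)
  have hgreat : IsGreatest X.rankValues (GraphPair.rank fun σ => (m σ : ℝ)) := by
    refine ⟨⟨_, ⟨hm, hm0⟩, rfl⟩, ?_⟩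
    rintro _ ⟨y, ⟨hy, hy0⟩, rfl⟩
    simpa using hmax y hy hy0
  have hleast : IsLeast X.rankValues (GraphPair.rank fun σ => (l σ : ℝ)) := by
    refine ⟨⟨_, ⟨hl, hl0⟩, rfl⟩, ?_⟩
    rintro _ ⟨y, ⟨hy, hy0⟩, rfl⟩
    simpa using hmin y hy hy0
  have hM : X.maxRank = GraphPair.rank fun σ => (m σ : ℝ) := hgreat.csSup_eq
  have hN : X.minRank = GraphPair.rank fun σ => (l σ : ℝ) := hleast.csInf_eq
  obtain ⟨q, hq⟩ := GraphPair.exists_rat_eq_rank m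
  obtain ⟨r, hr⟩ := GraphPair.exists_rat_eq_rank l
  rw [hM, hN]
  refine ⟨fun x hx h0 => ⟨GraphPair.degree_pos hx h0, GraphPair.degree_eq hx⟩, hgreat, hleast,
    GraphPair.exists_realizes hm hm0, GraphPair.exists_realizes hl hl0, ⟨q, ?_, hq⟩, ⟨r, ?_, hr⟩,
    fun h => ⟨?_, ?_⟩, ?_⟩
  · rw [← Rat.cast_nonneg (K := ℝ), hq]
    exact GraphPair.rank_nonneg hm hm0
  · rw [← Rat.cast_nonneg (K := ℝ), hr]
    exact GraphPair.rank_nonneg hl hl0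
  · exact div_pos (GraphPair.chiMinus_pos_of_hasIsolatedCycle h hl hl0)
      (GraphPair.degree_pos hl hl0)
  · exact div_pos (GraphPair.chiMinus_pos_of_hasIsolatedCycle h hm hm0)
      (GraphPair.degree_pos hm hm0)
  · rintro ⟨L, D, F, hL, hF, hD, x, hx⟩
    have hF0 : F.piVec ≠ 0 :=
      Function.ne_iff.2 ⟨_, (F.piVec_starAt_pos hL hD x).ne'⟩
    have hcone := F.piVec_mem_cone hL hD hF
    exact (div_pos (F.chiMinus_piVec_pos hL hD hx) (GraphPair.degree_pos hcone hF0)).trans_le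
      (hgreat.2 ⟨_, ⟨hcone, hF0⟩, rfl⟩)
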